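/- Use units $c=\hbar=k_B=1$ and the metric signature $(-,+,+,+)$. Consider a non-degenerate gas of identical spinless particles of mass $m\ge 0$, described in the rest frame of an inertial observer $\mathcal O$. Write $p^0=\sqrt{m^2+|p|^2}$ and $w^j=p^j/p^0$. Let $f_{\rm eq}(p)=e^{\alpha+\beta_\mu p^\mu}$, with $\beta^\mu$ timelike and future-directed, be a uniform equilibrium state (not necessarily at rest relative to $\mathcal O$), and let $\mathcal H=L^2(\mathbb R^3, f_{\rm eq}\,d^3p/(2\pi)^3)$, with complex-valued elements, inner product $(\cdot,\cdot)$ and norm $\|\cdot\|$. For a measurable differential cross section $\sigma(s,\theta)\ge 0$, the linearized collision operator is $$ (I\psi)(p)=\int\frac{d^3q}{(2\pi)^3}\,f_{\rm eq}(q)\int_{S^2}d\Omega\;\tfrac12\, v_{\text{Møl}}\,\sigma(s,\theta)\,\big[\psi(p)+\psi(q)-\psi(p')-\psi(q')\big], \qquad v_{\text{Møl}}=\frac{\sqrt{(p_\mu q^\mu)^2-m^4}}{p^0q^0}, $$ where $p',q'$ are the outgoing momenta of the elastic collision of $p$ and $q$ with scattering direction $\Omega$ in the center-of-mass frame, $s=-(p+q)_\mu(p+q)^\mu$,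 and $\theta$ is the center-of-mass scattering angle. Its domain consists of those $\psi\in\mathcal H$ for which the same integral with $[\cdots]$ replaced by $|[\cdots]|$ is, as a function of $p$, in $L^2(f_{\rm eq}\,d^3p/(2\pi)^3)$. Assume that this domain is dense in $\mathcal H$, and denote by $I$ also the Friedrichs extension of this operator. A wavevector $k^\mu=(\omega,k^j)\in\mathbb C^4$ is an eigenmode if there are $\psi_n$ in the domain of $I$ with $\|\psi_n\|=1$ and $\|(I-i\omega+i k_jw^j)\psi_n\|\to 0$. For $\psi\in\mathcal H$ let $$\delta J^\mu=\int \frac{d^3p}{(2\pi)^3} f_{\rm eq}\frac{p^\mu}{p^0}\psi ,\qquad \delta T^{\mu\nu}=\int \frac{d^3p}{(2\pi)^3} f_{\rm eq}\frac{p^\mu}{p^0}p^\nu\psi .$$ The non-hydrodynamic spectrum at zero wavenumber relative to an inertial observer with four-velocity $u^\mu$ is the set of all $\omega\in\mathbb C$ such that $k^\mu=\omega u^\mu$ is an eigenmode for which the sequence $\psi_n$ can be chosen so that $u_\mu\delta J^\mu=0$ and $u_\mu\delta T^{\mu\nu}=0$ ($\nu=0,\dots,3$) for every $\psi_n$. (This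 spectrum includes the continuous spectrum.) Theorem. Let $\mathcal O'$ be an inertial observer moving relative to $\mathcal O$ with speed $0\le v<1$, in any direction, and let $\gamma=(1-v^2)^{-1/2}$. Let $0\le a<\infty$ and $b\le\infty$. If the non-hydrodynamic spectrum at $k=0$ relative to $\mathcal O$ is confined to $a\le i\omega\le b$ (in particular $i\omega$ is real), then the non-hydrodynamic spectrum at $k'=0$ relative to $\mathcal O'$ is confined to $$\frac{a(1-v)}{\gamma}\;\le\; i\omega'\;\le\;\frac{b}{\gamma(1-v)}$$ (in particular $i\omega'$ is real; for $b=\infty$ the upper bound is void). -/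

import Mathlib

open MeasureTheory Filter Topology
open scoped NNReal ENNReal

noncomputable section

namespace Kinetic

/-- Momentum space `ℝ³` with its Euclidean norm. -/
abbrev Momentum : Type := EuclideanSpace ℝ (Fin 3)

/-- The unit sphere of `ℝ³`, the set of scattering directions. -/
abbrev Direction : Type := Metric.sphere (0 : Momentum) 1

/-! ### Relativistic kinematics (signature `(-,+,+,+)`, units `c = ħ = k_B = 1`) -/

/-- The Minkowski product `a_μ b^μ`. -/
def minkowski (a b : Fin 4 → ℝ) : ℝ :=
  -(a 0 * b 0) + ∑ j : Fin 3, a j.succ * b j.succ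

/-- The on-shell energy `p⁰ = √(m² + |p|²)`. -/
def energy (m : ℝ) (p : Momentum) : ℝ := Real.sqrt (m ^ 2 + ‖p‖ ^ 2)

/-- The on-shell four-momentum `p^μ = (p⁰, p)`. -/
def fourMomentum (m : ℝ) (p : Momentum) : Fin 4 → ℝ := Fin.cons (energy m p) fun j => p j

/-- The Lorentz factor `γ = 1 / √(1 - v²)` of a speed `v < 1`. -/
def lorentzFactor (v : ℝ) : ℝ := 1 / Real.sqrt (1 - v ^ 2)

/-- The four-velocity `u^μ = γ (1, V)` of an observer moving with velocity `V`. -/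
def fourVelocity (V : Momentum) : Fin 4 → ℝ :=
  fun μ => lorentzFactor ‖V‖ * (Fin.cons 1 (fun j => V j) : Fin 4 → ℝ) μ

/-- The Mandelstam invariant `s = -(p + q)_μ (p + q)^μ`, the squared center-of-mass energy. -/
def mandelstamS (m : ℝ) (p q : Momentum) : ℝ :=
  -minkowski (fourMomentum m p + fourMomentum m q) (fourMomentum m p + fourMomentum m q)

/-- The Møller velocity `√((p_μ q^μ)² - m⁴) / (p⁰ q⁰)`. -/
def mollerVelocity (m : ℝ) (p q : Momentum) : ℝ :=
  Real.sqrt ((minkowski (fourMomentum m p) (fourMomentum m q)) ^ 2 - m ^ 4)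
    / (energy m p * energy m q)

/-- The momentum `p'` of the first outgoing particle in an elastic collision of `p` with `q`.
In the center-of-mass frame it has direction `ω` and length `κ = √(s - 4 m²) / 2`; the formula
is its image under the pure boost from the center-of-mass frame. -/
def outgoing (m : ℝ) (p q ω : Momentum) : Momentum :=
  (1 / 2 : ℝ) • (p + q) +
    (Real.sqrt (mandelstamS m p q - 4 * m ^ 2) / 2) •
      (ω + (inner ℝ (p + q) ω / (Real.sqrt (mandelstamS m p q) *
        (energy m p + energy m q + Real.sqrt (mandelstamS m p q)))) • (p + q))

/-- The momentum `q' = p + q - p'` of the second outgoing particle. -/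
def outgoingPartner (m : ℝ) (p q ω : Momentum) : Momentum := p + q - outgoing m p q ω

/-- The cosine of the center-of-mass scattering angle, as the invariant
`(p - q)_μ (p' - q')^μ / (s - 4 m²)`. -/
def cosScattering (m : ℝ) (p q ω : Momentum) : ℝ :=
  minkowski (fourMomentum m p - fourMomentum m q)
      (fourMomentum m (outgoing m p q ω) - fourMomentum m (outgoingPartner m p q ω))
    / (mandelstamS m p q - 4 * m ^ 2)

/-! ### Gases and their Hilbert space -/

/-- A non-degenerate gas of identical spinless particles together with a uniform equilibrium
state of it, described in the rest frame of a fixed observer (who need not comove with the gas). -/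
structure Gas where
  /-- The mass of the particles; massless particles are allowed. -/
  mass : ℝ
  mass_nonneg : 0 ≤ mass
  /-- The fugacity exponent of the equilibrium state. -/
  α : ℝ
  /-- Time component of the inverse-temperature four-vector `β^μ = u_gas^μ / T`. -/
  β₀ : ℝ
  /-- Space components of the inverse-temperature four-vector. -/
  β : Momentum
  /-- `β^μ` is timelike and future-directed. -/
  β_timelike : ‖β‖ < β₀
  /-- The differential cross section, a function of `s` and of the cosine of the
  center-of-mass scattering angle. -/
  crossSection : ℝ → ℝ → ℝ≥0
  measurable_crossSection : Measurable (Function.uncurry crossSection)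

namespace Gas

variable (G : Gas)

/-- The equilibrium (Maxwell–Jüttner) distribution `f_eq = exp(α + β_μ p^μ)`. -/
def feq (p : Momentum) : ℝ :=
  Real.exp (G.α + minkowski (Fin.cons G.β₀ fun j => G.β j) (fourMomentum G.mass p))

/-- The measure `f_eq d³p / (2π)³`. -/
def measure : Measure Momentum :=
  volume.withDensity fun p => ENNReal.ofReal (G.feq p / (2 * Real.pi) ^ 3)

/-- The Hilbert space `L²(ℝ³, f_eq d³p / (2π)³)` of complex perturbations `ψ`. -/
abbrev State : Type := Lp ℂ 2 G.measure

/-! ### The linearized collision operator -/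

/-- The measure `(f_eq(q) d³q / (2π)³) dΩ` over collision partners and scattering directions. -/
def partnerMeasure : Measure (Momentum × Direction) :=
  G.measure.prod (volume : Measure Momentum).toSphere

/-- The collision rate `v_Møl σ(s, θ) / 2`, with the factor `1 / 2` of identical particles. -/
def rate (p : Momentum) (z : Momentum × Direction) : ℝ :=
  mollerVelocity G.mass p z.1 *
    G.crossSection (mandelstamS G.mass p z.1) (cosScattering G.mass p z.1 z.2) / 2

/-- The collisional balance `ψ(p) + ψ(q) - ψ(p') - ψ(q')`. -/
def balance (ψ : Momentum → ℂ) (p : Momentum) (z : Momentum × Direction) : ℂ :=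
  ψ p + ψ z.1 - ψ (outgoing G.mass p z.1 z.2) - ψ (outgoingPartner G.mass p z.1 z.2)

/-- The linearized collision integral
`(Iψ)(p) = ∫ (d³q/(2π)³) f_eq(q) ∫ dΩ (v_Møl σ / 2) (ψ(p) + ψ(q) - ψ(p') - ψ(q'))`. -/
def collisionIntegral (ψ : Momentum → ℂ) (p : Momentum) : ℂ :=
  ∫ z, (G.rate p z : ℂ) * G.balance ψ p z ∂G.partnerMeasure

/-- The collision integral of `ψ` with absolute values inside. -/
def absCollisionIntegral (ψ : Momentum → ℂ) (p : Momentum) : ℝ≥0∞ :=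
  ∫⁻ z, ‖(G.rate p z : ℂ) * G.balance ψ p z‖ₑ ∂G.partnerMeasure

/-- The natural domain of the linearized collision operator: the states whose collision integral
converges absolutely, to a square-integrable function. -/
def collisionDomain : Set G.State :=
  {ψ | ∫⁻ p, G.absCollisionIntegral ψ p ^ 2 ∂G.measure < ∞}

/-- The graph of the linearized collision operator on its natural domain. -/
def collisionGraph : Set (G.State × G.State) :=
  {x | x.1 ∈ G.collisionDomain ∧ x.2 =ᵐ[G.measure] G.collisionIntegral x.1}

end Gas

/-- The graph of the Friedrichs extension of a densely defined, symmetric, nonnegative operator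
`T` that is given by its graph: the restriction of the adjoint `T*` to the form domain, i.e. to
the limits of those sequences in the domain of `T` that are Cauchy for the form `(ψ, T ψ)`. -/
def friedrichsGraph {H : Type*} [NormedAddCommGroup H] [InnerProductSpace ℂ H]
    (T : Set (H × H)) : Set (H × H) :=
  {x | (∀ y ∈ T, inner ℂ y.2 x.1 = inner ℂ y.1 x.2) ∧
    ∃ z : ℕ → H × H, (∀ n, z n ∈ T) ∧ Tendsto (fun n => (z n).1) atTop (𝓝 x.1) ∧
      Tendsto (fun mn : ℕ × ℕ =>
        (inner ℂ ((z mn.1).1 - (z mn.2).1) ((z mn.1).2 - (z mn.2).2) : ℂ)) atTop (𝓝 0)}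

namespace Gas

variable (G : Gas)

/-- The graph of the collision operator `I`: the Friedrichs extension of the linearized collision
operator on its natural domain. -/
def collisionOperator : Set (G.State × G.State) := friedrichsGraph G.collisionGraph

/-! ### Eigenmodes, conserved currents and the non-hydrodynamic spectrum -/

/-- The velocity components `w^j = p^j / p⁰`. -/
def velocity (j : Fin 3) (p : Momentum) : ℝ := p j / energy G.mass p

/-- `x n = (ψ_n, I ψ_n)` is a sequence of normalized states in the domain of `I` with
`‖(I - iω + i k_j w^j) ψ_n‖ → 0`, where `k^μ = (ω, k^j)`: it exhibits `k^μ` as an eigenmode,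
belonging to the point or to the continuous spectrum. -/
def IsEigenSequence (k : Fin 4 → ℂ) (x : ℕ → G.State × G.State) : Prop :=
  (∀ n, x n ∈ G.collisionOperator) ∧ (∀ n, ‖(x n).1‖ = 1) ∧
    Tendsto (fun n => eLpNorm (fun p => (x n).2 p - Complex.I * k 0 * (x n).1 p +
      (∑ j : Fin 3, (G.velocity j p : ℂ) * (Complex.I * k j.succ)) * (x n).1 p) 2 G.measure)
      atTop (𝓝 0)

/-- The perturbation `δJ^μ = ∫ (d³p/(2π)³) f_eq (p^μ/p⁰) ψ` of the particle current. -/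
def currentJ (ψ : G.State) (μ : Fin 4) : ℂ :=
  ∫ p, ((fourMomentum G.mass p μ / energy G.mass p : ℝ) : ℂ) * ψ p ∂G.measure

/-- The perturbation `δT^{μν} = ∫ (d³p/(2π)³) f_eq (p^μ/p⁰) p^ν ψ` of the stress-energy tensor. -/
def currentT (ψ : G.State) (μ ν : Fin 4) : ℂ :=
  ∫ p, ((fourMomentum G.mass p μ / energy G.mass p * fourMomentum G.mass p ν : ℝ) : ℂ) * ψ p
    ∂G.measure

/-- The contraction `u_μ A^μ` of a real four-vector with a complex one. -/
def contract (u : Fin 4 → ℝ) (A : Fin 4 → ℂ) : ℂ :=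
  -((u 0 : ℂ) * A 0) + ∑ j : Fin 3, (u j.succ : ℂ) * A j.succ

/-- The state carries no conserved density relative to the observer with four-velocity `u`:
`u_μ δJ^μ = 0` and `u_μ δT^{μν} = 0`. -/
def NoConservedDensity (u : Fin 4 → ℝ) (ψ : G.State) : Prop :=
  contract u (G.currentJ ψ) = 0 ∧ ∀ ν, contract u (fun μ => G.currentT ψ μ ν) = 0

/-- The non-hydrodynamic spectrum at zero wavenumber relative to the observer with velocity `V`:
the frequencies `ω` for which `k^μ = ω u^μ` is an eigenmode, exhibited by a sequence of states
that carry no conserved density relative to that observer. -/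
def nonhydroSpectrum (V : Momentum) : Set ℂ :=
  {ω | ∃ x : ℕ → G.State × G.State,
    G.IsEigenSequence (fun μ => ω * (fourVelocity V μ : ℂ)) x ∧
      ∀ n, G.NoConservedDensity (fourVelocity V) (x n).1}

end Gas

/-- For every frequency `ω` in the set, `iω` is a real number with `a ≤ iω ≤ b`. -/
def Confined (S : Set ℂ) (a : ℝ) (b : EReal) : Prop :=
  ∀ ω ∈ S, ∃ r : ℝ, Complex.I * ω = (r : ℂ) ∧ a ≤ r ∧ (r : EReal) ≤ b

end Kinetic

end

/-! The change of observer does not alter the collision operator, only what multiplies the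
frequency. For $k^\mu=\omega u^\mu$ the eigenmode equation reads $I\psi=i\omega M\psi$, where $M$ is
multiplication by $\gamma(1-V\cdot w)$, a function with values between $c=\gamma(1-v)$ and
$C=\gamma(1+v)$. The absence of conserved densities reads $M\psi\perp N$, where $N$ is the span of
the collision invariants $1,p^\nu$. For $V=0$ one has $M=1$, so the hypothesis concerns $I$
restricted to $N^\perp$.

Write $\psi=\varphi+\nu$ with $\nu\in N$ and $\varphi\perp N$. Since $I$ is self-adjoint,
nonnegative and vanishes on $N$, the hypothesis gives $a\|\varphi\|^2\le(\psi,I\psi)\le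
b\|\varphi\|^2$. The orthogonality $M\psi\perp N$ removes the cross terms and gives
$(\varphi,M\varphi)=(\psi,M\psi)+(\nu,M\nu)$, hence $c\|\psi\|^2\le(\psi,M\psi)\le C\|\varphi\|^2$.
Along an eigensequence $(\psi,I\psi)-i\omega(\psi,M\psi)\to0$, so $i\omega$ is real and lies between
$a/C$ and $b/c$. This is `exists_real_eq_of_isSelfAdjoint_multiplier`.

The unbounded operator enters only through its resolvent $R=(I+1)^{-1}$, built in
`exists_friedrichs_resolvent`. The spectral hypothesis becomes a statement about the bounded
operator $R-P_N$ (`exists_eq_inv_sub_one_of_mem_spectrum`), and continuous functional calculus turns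
it into the form bounds.

The Friedrichs construction needs symmetry and positivity on the natural domain. Both follow from
$4(\chi,I\psi)=\int\overline{\Delta\chi}\,\Delta\psi$ (`four_mul_inner_eq`), with $\Delta$ the
collisional balance. This rests on the invariance of the equilibrium collision measure under
exchange of the particles and of incoming with outgoing momenta. The latter
(`lintegral_collision_swap`) is proved in center-of-mass variables, where the Jacobian of the boost
combines with the Møller velocity into a weight that depends on the relative momentum only through
its length. -/

namespace Kinetic

/-! ### Spectral bounds for bounded self-adjoint operators -/

section SelfAdjoint

variable {H : Type*} [NormedAddCommGroup H] [InnerProductSpace ℂ H] [CompleteSpace H]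

/-- A self-adjoint operator has no residual spectrum: if $B-\mu$ is bounded below it is injective,
and the orthogonal complement of its range is its own kernel, so the range is dense and $B-\mu$ is
invertible. -/
theorem exists_norm_sub_lt_of_mem_spectrum {B : H →L[ℂ] H} (hB : IsSelfAdjoint B) {μ : ℝ}
    (hμ : μ ∈ spectrum ℝ B) {ε : ℝ} (hε : 0 < ε) :
    ∃ h : H, ‖h‖ = 1 ∧ ‖B h - (μ : ℂ) • h‖ < ε := by
  by_contra! hne
  have hbound : ∀ h : H, ε * ‖h‖ ≤ ‖B h - (μ : ℂ) • h‖ := by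
    intro h
    rcases eq_or_ne h 0 with rfl | h0
    · simp
    have hn : ‖h‖ ≠ 0 := norm_ne_zero_iff.2 h0
    have h1 : ‖((‖h‖⁻¹ : ℝ) : ℂ) • h‖ = 1 := by
      rw [norm_smul, Complex.norm_real, norm_inv, norm_norm, inv_mul_cancel₀ hn]
    have h2 := hne _ h1
    rw [map_smul, smul_comm, ← smul_sub, norm_smul, Complex.norm_real, norm_inv, norm_norm] at h2
    rw [inv_mul_eq_div, le_div_iff₀ (norm_pos_iff.2 h0)] at h2
    exact h2
  set C : H →L[ℂ] H := B - (μ : ℂ) • (1 : H →L[ℂ] H) with hC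
  have hCs : IsSelfAdjoint C := by
    refine hB.sub (IsSelfAdjoint.smul ?_ (IsSelfAdjoint.one _))
    simp [isSelfAdjoint_iff]
  have hCanti : ∃ K : ℝ≥0, AntilipschitzWith K C := by
    refine ⟨⟨ε⁻¹, by positivity⟩, ContinuousLinearMap.antilipschitz_of_bound C fun x => ?_⟩
    have := hbound x
    change ‖x‖ ≤ ε⁻¹ * ‖C x‖
    rw [inv_mul_eq_div, le_div_iff₀ hε, mul_comm]
    simpa [hC] using this
  have hunit : IsUnit C := by
    rw [ContinuousLinearMap.isUnit_iff_bijective,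
      ContinuousLinearMap.bijective_iff_dense_range_and_antilipschitz]
    refine ⟨?_, hCanti⟩
    rw [Submodule.topologicalClosure_eq_top_iff, ContinuousLinearMap.orthogonal_range,
      hCs.adjoint_eq]
    obtain ⟨K, hK⟩ := hCanti
    exact LinearMap.ker_eq_bot.2 hK.injective
  refine hμ ?_
  have : algebraMap ℝ (H →L[ℂ] H) μ - B = -C := by
    ext x
    simp [hC, Algebra.algebraMap_eq_smul_one]
  rw [spectrum.mem_resolventSet_iff, this]
  exact hunit.neg

/-- Functional calculus applied to $\mu-c\mu^2\ge0$. Weighting by $\|Bh\|^2$ instead of $\|h\|^2$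
suits resolvents: for $B=(A+1)^{-1}$ and $\varphi=Bh$, the right side is
$\|\varphi\|^2+(\varphi,A\varphi)$, so this is a lower bound on the form of $A$. -/
theorem mul_norm_sq_le_re_inner {B : H →L[ℂ] H} (hB : IsSelfAdjoint B) {c : ℝ}
    (hc : ∀ μ ∈ spectrum ℝ B, c * μ ^ 2 ≤ μ) (h : H) :
    c * ‖B h‖ ^ 2 ≤ (inner ℂ (B h) h).re := by
  have h1 : (0 : H →L[ℂ] H) ≤ cfc (fun μ : ℝ => μ - c * μ ^ 2) B :=
    cfc_nonneg fun x hx => sub_nonneg.2 (hc x hx)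
  rw [cfc_sub _ _ B, cfc_const_mul _ _ B, cfc_pow _ _ B, cfc_id' ℝ B,
    ContinuousLinearMap.nonneg_iff_isPositive] at h1
  have h2 := h1.inner_nonneg_left h
  have h3 : inner ℂ (B (B h)) h = ((‖B h‖ ^ 2 : ℝ) : ℂ) := by
    rw [← ContinuousLinearMap.adjoint_inner_right, hB.adjoint_eq, inner_self_eq_norm_sq_to_K]
    simp
  have h4 := (Complex.le_def.1 h2).1
  simp only [sub_apply, smul_apply, pow_two B,
    mul_apply_eq_comp, inner_sub_left] at h4
  rw [← Complex.coe_smul, inner_smul_left, h3] at h4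
  simp only [Complex.zero_re, Complex.conj_ofReal, Complex.sub_re, ← Complex.ofReal_mul,
    Complex.ofReal_re] at h4
  linarith

theorem re_inner_le_mul_norm_sq {B : H →L[ℂ] H} (hB : IsSelfAdjoint B) {c : ℝ}
    (hc : ∀ μ ∈ spectrum ℝ B, μ ≤ c * μ ^ 2) (h : H) :
    (inner ℂ (B h) h).re ≤ c * ‖B h‖ ^ 2 := by
  have := mul_norm_sq_le_re_inner hB.neg (c := -c) (fun μ hμ => ?_) h
  · simp at this
    linarith
  · rw [← spectrum.neg_eq, Set.mem_neg] at hμ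
    have := hc _ hμ
    nlinarith

end SelfAdjoint

/-! ### The Friedrichs extension through its resolvent -/

section Friedrichs

variable {H : Type*} [NormedAddCommGroup H] [InnerProductSpace ℂ H]

/-- The form domain of a nonnegative symmetric operator, before completion: the graph of the
operator, to be normed by `‖ψ‖² + (ψ, T ψ)`. -/
def FormDomain (T : Submodule ℂ (H × H)) : Type _ := T

namespace FormDomain

variable (T : Submodule ℂ (H × H))

instance : AddCommGroup (FormDomain T) := inferInstanceAs (AddCommGroup T)

instance : Module ℂ (FormDomain T) := inferInstanceAs (Module ℂ T)

/-- The inner product `(ψ, φ) + (ψ, T φ)` on the domain of a nonnegative symmetric operator. -/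
@[reducible]
noncomputable def core (hsymm : ∀ x ∈ T, ∀ y ∈ T, inner ℂ y.2 x.1 = inner ℂ y.1 x.2)
    (hnonneg : ∀ x ∈ T, 0 ≤ (inner ℂ x.1 x.2).re) :
    PreInnerProductSpace.Core ℂ (FormDomain T) where
  inner x y := inner ℂ x.1.1 y.1.1 + inner ℂ x.1.1 y.1.2
  conj_inner_symm x y := by
    rw [map_add, inner_conj_symm, inner_conj_symm]
    exact congrArg _ (hsymm _ y.2 _ x.2)
  re_inner_nonneg x := by
    have := hnonneg _ x.2
    have h2 := inner_self_nonneg (𝕜 := ℂ) (x := x.1.1)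
    rw [map_add]
    exact add_nonneg h2 this
  add_left x y z := by
    change inner ℂ (x.1.1 + y.1.1) z.1.1 + inner ℂ (x.1.1 + y.1.1) z.1.2 = _
    rw [inner_add_left, inner_add_left]
    ring
  smul_left x y r := by
    change inner ℂ (r • x.1.1) y.1.1 + inner ℂ (r • x.1.1) y.1.2 = _
    rw [inner_smul_left, inner_smul_left, mul_add]

end FormDomain

theorem subset_friedrichsGraph {T : Set (H × H)}
    (hsymm : ∀ x ∈ T, ∀ y ∈ T, inner ℂ y.2 x.1 = inner ℂ y.1 x.2) : T ⊆ friedrichsGraph T :=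
  fun x hx => ⟨fun y hy => hsymm x hx y hy, fun _ => x, fun _ => hx, tendsto_const_nhds, by simp⟩

variable [CompleteSpace H]

/-- The Friedrichs extension `A` has a self-adjoint bounded resolvent `R = (A + 1)⁻¹`: with `J` the
inclusion of the completed form domain, `R = J J†`. -/
theorem exists_friedrichs_resolvent (T : Submodule ℂ (H × H))
    (hsymm : ∀ x ∈ T, ∀ y ∈ T, inner ℂ y.2 x.1 = inner ℂ y.1 x.2)
    (hnonneg : ∀ x ∈ T, 0 ≤ (inner ℂ x.1 x.2).re) :
    ∃ R : H →L[ℂ] H, IsSelfAdjoint R ∧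
      ∀ x : H × H, x ∈ friedrichsGraph (T : Set (H × H)) ↔ x.1 = R (x.1 + x.2) := by
  let c := FormDomain.core T hsymm hnonneg
  let i1 : SeminormedAddCommGroup (FormDomain T) :=
    InnerProductSpace.Core.toSeminormedAddCommGroup (𝕜 := ℂ)
  let i2 : InnerProductSpace ℂ (FormDomain T) := InnerProductSpace.ofCore c
  have hinner : ∀ x y : FormDomain T,
      inner ℂ x y = inner ℂ x.1.1 y.1.1 + inner ℂ x.1.1 y.1.2 := fun _ _ => rfl
  have hnormsq : ∀ x : FormDomain T,
      ‖x‖ ^ 2 = ‖x.1.1‖ ^ 2 + (inner ℂ x.1.1 x.1.2).re := by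
    intro x
    rw [← inner_self_eq_norm_sq (𝕜 := ℂ) x, hinner, map_add, inner_self_eq_norm_sq]
    rfl
  let ι₀ : FormDomain T →ₗ[ℂ] H :=
    { toFun := fun x => x.1.1
      map_add' := fun _ _ => rfl
      map_smul' := fun _ _ => rfl }
  let ι : FormDomain T →L[ℂ] H := ι₀.mkContinuous 1 fun x => by
    rw [one_mul]
    refine le_of_sq_le_sq ?_ (norm_nonneg _)
    rw [hnormsq]
    exact le_add_of_nonneg_right (hnonneg _ x.2)
  let Q := UniformSpace.Completion (FormDomain T)
  let J : Q →L[ℂ] H := ι.extend (UniformSpace.Completion.toComplL (𝕜 := ℂ))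
  have hJ : ∀ x : FormDomain T, J (x : Q) = x.1.1 := fun x =>
    ι.extend_eq (UniformSpace.Completion.denseRange_coe)
      (UniformSpace.Completion.isUniformInducing_coe _) x
  let Jd : H →L[ℂ] Q := ContinuousLinearMap.adjoint J
  -- The form inner product with $y$ is $((1+T)y,J\eta)$. For $\eta$ in the domain this is the
  -- symmetry of $T$, and both sides are continuous in $\eta$.
  have hkey : ∀ (η : Q) (z : ℕ → FormDomain T), Tendsto (fun n => (z n : Q)) atTop (𝓝 η) →
      ∀ y : FormDomain T, inner ℂ (y : Q) η = inner ℂ y.1.1 (J η) + inner ℂ y.1.2 (J η) := by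
    intro η z hz y
    have h1 : Tendsto (fun n => inner ℂ (y : Q) (z n : Q)) atTop (𝓝 (inner ℂ (y : Q) η)) :=
      tendsto_const_nhds.inner hz
    have h2 : Tendsto (fun n => J (z n : Q)) atTop (𝓝 (J η)) := (J.continuous.tendsto _).comp hz
    have h3 := (tendsto_const_nhds (x := y.1.1)).inner (𝕜 := ℂ) h2
    have h4 := (tendsto_const_nhds (x := y.1.2)).inner (𝕜 := ℂ) h2
    refine tendsto_nhds_unique h1 ((h3.add h4).congr fun n => ?_)
    rw [UniformSpace.Completion.inner_coe, hinner, hJ, hsymm _ (z n).2 _ y.2]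
  have hseq : ∀ η : Q, ∃ z : ℕ → FormDomain T, Tendsto (fun n => (z n : Q)) atTop (𝓝 η) := by
    intro η
    obtain ⟨u, hu, hlim⟩ :=
      mem_closure_iff_seq_limit.1 (UniformSpace.Completion.denseRange_coe (α := FormDomain T) η)
    choose z hz using hu
    exact ⟨z, by simpa only [hz] using hlim⟩
  refine ⟨J ∘L Jd, ?_, fun x => ⟨?_, fun hx => ⟨?_, ?_⟩⟩⟩
  · rw [ContinuousLinearMap.isSelfAdjoint_iff', ContinuousLinearMap.adjoint_comp,
      ContinuousLinearMap.adjoint_adjoint]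
  · rintro ⟨hadj, z, hz, hlim, hcauchy⟩
    let w : ℕ → FormDomain T := fun n => ⟨z n, hz n⟩
    -- The squared form norm is the sum of the squared $H$-norm and the form of $T$; the sequence is
    -- Cauchy for both.
    have hw : CauchySeq (fun n => (w n : Q)) := by
      rw [cauchySeq_iff_tendsto_dist_atTop_0]
      have hd : Tendsto (fun mn : ℕ × ℕ => ‖(z mn.1).1 - (z mn.2).1‖) atTop (𝓝 0) := by
        have := cauchySeq_iff_tendsto_dist_atTop_0.1 hlim.cauchySeq
        simpa only [dist_eq_norm] using this
      have hr := (Complex.continuous_re.tendsto _).comp hcauchy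
      have hs := (hd.pow 2).add hr
      simp only [Function.comp_def, Complex.zero_re, ne_eq, OfNat.ofNat_ne_zero,
        not_false_eq_true, zero_pow, add_zero] at hs
      have hsq := (Real.continuous_sqrt.tendsto _).comp hs
      rw [Real.sqrt_zero] at hsq
      refine hsq.congr fun mn => ?_
      rw [dist_eq_norm, ← UniformSpace.Completion.coe_sub, UniformSpace.Completion.norm_coe,
        ← Real.sqrt_sq (norm_nonneg (w mn.1 - w mn.2)), hnormsq]
      rfl
    obtain ⟨η, hη⟩ := cauchySeq_tendsto_of_complete hw
    have hJη : J η = x.1 := by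
      refine tendsto_nhds_unique ((J.continuous.tendsto _).comp hη) (hlim.congr fun n => ?_)
      exact (hJ (w n)).symm
    -- It suffices to test against the dense image of the domain, where the adjoint condition on `x`
    -- moves $T$ across.
    have hη2 : η = Jd (x.1 + x.2) := by
      refine ext_inner_left ℂ fun v => ?_
      induction v using UniformSpace.Completion.induction_on with
      | hp => exact isClosed_eq (by fun_prop) (by fun_prop)
      | ih y =>
        rw [hkey η w hη y, ContinuousLinearMap.adjoint_inner_right, hJ, hJη, hadj _ y.2,
          inner_add_right]
    rw [ContinuousLinearMap.comp_apply, ← hη2, hJη]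
  · intro y hy
    -- Any approximation of $J^\dagger(x_1+x_2)$ from the domain can be used: its pairing with $y$
    -- is $(y_1,x_1+x_2)$, and by `hkey` also $(y_1,x_1)+(y_2,x_1)$.
    obtain ⟨z, hz⟩ := hseq (Jd (x.1 + x.2))
    let y' : FormDomain T := ⟨y, hy⟩
    have h1 := hkey _ _ hz y'
    rw [ContinuousLinearMap.adjoint_inner_right, hJ, ← ContinuousLinearMap.comp_apply, ← hx,
      inner_add_right] at h1
    exact (add_left_cancel h1).symm
  · obtain ⟨z, hz⟩ := hseq (Jd (x.1 + x.2))
    have hlim : Tendsto (fun n => (z n).1.1) atTop (𝓝 x.1) := by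
      rw [hx]
      exact ((J.continuous.tendsto _).comp hz).congr fun n => hJ (z n)
    refine ⟨fun n => (z n).1, fun n => (z n).2, hlim, ?_⟩
    have h1 := (cauchySeq_iff_tendsto_dist_atTop_0.1 hz.cauchySeq).pow 2
    have h2 := (cauchySeq_iff_tendsto_dist_atTop_0.1 hlim.cauchySeq).pow 2
    have h3 := (Complex.continuous_ofReal.tendsto _).comp (h1.sub h2)
    simp only [Function.comp_def, ne_eq, OfNat.ofNat_ne_zero, not_false_eq_true, zero_pow,
      sub_zero, Complex.ofReal_zero] at h3
    refine h3.congr fun mn => ?_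
    have h4 := inner_self_eq_norm_sq_to_K (𝕜 := ℂ) (z mn.1 - z mn.2)
    rw [hinner] at h4
    change inner ℂ ((z mn.1).1.1 - (z mn.2).1.1) ((z mn.1).1.1 - (z mn.2).1.1) +
      inner ℂ ((z mn.1).1.1 - (z mn.2).1.1) ((z mn.1).1.2 - (z mn.2).1.2) = _ at h4
    rw [inner_self_eq_norm_sq_to_K] at h4
    rw [dist_eq_norm, ← UniformSpace.Completion.coe_sub, UniformSpace.Completion.norm_coe,
      dist_eq_norm, Complex.ofReal_sub, sub_eq_iff_eq_add', Complex.ofReal_pow,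
      Complex.ofReal_pow]
    exact h4.symm

end Friedrichs

/-! ### The generalized eigenvalue problem against the spectrum on the complement of the invariants
-/

section Comparison

variable {H : Type*} [NormedAddCommGroup H] [InnerProductSpace ℂ H] [CompleteSpace H]

/-- Let `R = (A + 1)⁻¹` and let `A` vanish on `N`. If the approximate eigenvalues of `A` on the
orthogonal complement of `N` lie in `S`, then the nonzero points `μ` of the spectrum of
`R - P_N` satisfy `μ⁻¹ - 1 ∈ S`. -/
theorem exists_eq_inv_sub_one_of_mem_spectrum {R : H →L[ℂ] H} (hR : IsSelfAdjoint R)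
    (N : Submodule ℂ H) [N.HasOrthogonalProjection] (hN : ∀ ν ∈ N, R ν = ν) {S : Set ℝ}
    (hspec : ∀ ω : ℂ, (∃ x : ℕ → H × H, (∀ n, (x n).1 = R ((x n).1 + (x n).2)) ∧
      (∀ n, ‖(x n).1‖ = 1) ∧ (∀ n, (x n).1 ∈ Nᗮ) ∧
      Tendsto (fun n => ‖(x n).2 - (Complex.I * ω) • (x n).1‖) atTop (𝓝 0)) →
      ∃ r : ℝ, Complex.I * ω = r ∧ r ∈ S) {μ : ℝ}
    (hμ : μ ∈ spectrum ℝ (R - N.starProjection)) (hμ0 : μ ≠ 0) : μ⁻¹ - 1 ∈ S := by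
  have hB : IsSelfAdjoint (R - N.starProjection) := hR.sub (isSelfAdjoint_starProjection N)
  have hμpos : 0 < |μ| := abs_pos.2 hμ0
  choose h hnorm hlt using fun n : ℕ => exists_norm_sub_lt_of_mem_spectrum hB hμ
    (ε := |μ| / 2 / (n + 1)) (by positivity)
  set P := Nᗮ.starProjection with hP
  have hPN : ∀ y, y = N.starProjection y + P y := fun y =>
    (N.starProjection_add_starProjection_orthogonal y).symm
  set B := R - N.starProjection with hBdef
  have hBP : ∀ y, B y = R (P y) := by
    intro y
    have h1 := hN _ (N.starProjection_apply_mem y)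
    have h2 := congrArg R (hPN y)
    rw [map_add, h1] at h2
    simp [hBdef, h2]
  have hBmem : ∀ y, B y ∈ Nᗮ := by
    intro y
    rw [Submodule.mem_orthogonal]
    intro ν hν
    rw [← ContinuousLinearMap.adjoint_inner_left, hB.adjoint_eq]
    simp [hBdef, hN ν hν, N.starProjection_eq_self_iff.2 hν]
  -- The approximate eigenvectors `h n` need not lie in the domain of $A$. Their images do, because
  -- $B=RP$ with $P$ the projection onto $N^\perp$; these are also orthogonal to $N$, and their
  -- norms stay above $|\mu|/2$.
  set φ : ℕ → H := fun n => B (h n) with hφ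
  have hφlow : ∀ n, |μ| / 2 ≤ ‖φ n‖ := by
    intro n
    have h1 := hlt n
    have h2 : |μ| / 2 / ((n : ℝ) + 1) ≤ |μ| / 2 := div_le_self (by positivity) (by simp)
    have h3 : ‖(μ : ℂ) • h n‖ = |μ| := by rw [norm_smul, hnorm, mul_one, Complex.norm_real]; rfl
    have h4 := norm_sub_norm_le ((μ : ℂ) • h n) (B (h n))
    rw [norm_sub_rev, h3] at h4
    change |μ| / 2 ≤ ‖B (h n)‖
    linarith
  have hφpos : ∀ n, 0 < ‖φ n‖ := fun n => lt_of_lt_of_le (by positivity) (hφlow n)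
  set t : ℕ → ℂ := fun n => ((‖φ n‖⁻¹ : ℝ) : ℂ) with ht
  have htnorm : ∀ n, ‖t n‖ = ‖φ n‖⁻¹ := fun n => by
    simp only [ht]; rw [Complex.norm_real, norm_inv, norm_norm]
  have hI : Complex.I * (-Complex.I * ((μ⁻¹ - 1 : ℝ) : ℂ)) = ((μ⁻¹ - 1 : ℝ) : ℂ) := by
    rw [← mul_assoc, mul_neg, Complex.I_mul_I, neg_neg, one_mul]
  suffices hex : ∃ r : ℝ, Complex.I * (-Complex.I * ((μ⁻¹ - 1 : ℝ) : ℂ)) = r ∧ r ∈ S by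
    obtain ⟨r, hr, hrS⟩ := hex
    rw [hI] at hr
    rwa [Complex.ofReal_injective hr]
  -- Since $\varphi=RPh$, one has $A\varphi=Ph-\varphi$. The scalar `t n` normalizes.
  refine hspec _ ⟨fun n => (t n • φ n, t n • (P (h n) - φ n)), ?_, ?_, ?_, ?_⟩
  · intro n
    simp only
    rw [← smul_add, add_sub_cancel, map_smul, ← hBP]
  · intro n
    simp only
    rw [norm_smul, htnorm, inv_mul_cancel₀ (hφpos n).ne']
  · exact fun n => Submodule.smul_mem _ _ (hBmem _)
  · have hbd : Tendsto (fun n : ℕ => |μ|⁻¹ * (1 / ((n : ℝ) + 1))) atTop (𝓝 0) := by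
      simpa using (tendsto_one_div_add_atTop_nhds_zero_nat (𝕜 := ℝ)).const_mul (|μ|⁻¹)
    refine squeeze_zero (fun n => norm_nonneg _) (fun n => ?_) hbd
    have hPφ : P (φ n) = φ n := (Nᗮ.starProjection_eq_self_iff).2 (hBmem _)
    -- The residual is $Ph-\mu^{-1}\varphi=-\mu^{-1}P(Bh-\mu h)$, because $P\varphi=\varphi$.
    have h1 : t n • (P (h n) - φ n) -
        (Complex.I * (-Complex.I * ((μ⁻¹ - 1 : ℝ) : ℂ))) • t n • φ n =
        -(t n * ((μ⁻¹ : ℝ) : ℂ)) • P (B (h n) - (μ : ℂ) • h n) := by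
      have h0 : Complex.I * (-Complex.I * ((μ⁻¹ - 1 : ℝ) : ℂ)) = ((μ⁻¹ : ℝ) : ℂ) - 1 := by
        rw [hI, Complex.ofReal_sub, Complex.ofReal_one]
      have hμ1 : ((μ⁻¹ : ℝ) : ℂ) * (μ : ℂ) = 1 := by
        rw [← Complex.ofReal_mul, inv_mul_cancel₀ hμ0, Complex.ofReal_one]
      rw [h0, map_sub, map_smul, show B (h n) = φ n from rfl, hPφ, smul_sub, smul_sub, smul_smul,
        smul_smul, neg_mul, mul_assoc (t n), hμ1, mul_one]
      module
    rw [h1, norm_smul, norm_neg, norm_mul, htnorm, Complex.norm_real, norm_inv, Real.norm_eq_abs]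
    have h2 : ‖P (B (h n) - (μ : ℂ) • h n)‖ ≤ |μ| / 2 / ((n : ℝ) + 1) :=
      (Nᗮ.norm_starProjection_apply_le _).trans (hlt n).le
    have h3 : ‖φ n‖⁻¹ ≤ (|μ| / 2)⁻¹ := inv_anti₀ (by positivity) (hφlow n)
    calc ‖φ n‖⁻¹ * |μ|⁻¹ * ‖P (B (h n) - (μ : ℂ) • h n)‖
        ≤ (|μ| / 2)⁻¹ * |μ|⁻¹ * (|μ| / 2 / ((n : ℝ) + 1)) := by gcongr
      _ = |μ|⁻¹ * (1 / ((n : ℝ) + 1)) := by field_simp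

/-- Comparison of the generalized eigenvalue problem `A ψ = λ M ψ` on the states with `M ψ ⊥ N`
with the spectrum of `A` on the orthogonal complement of `N`, where `R = (A + 1)⁻¹`, `A` vanishes
on `N` and `c ≤ M ≤ C`. -/
theorem exists_real_eq_of_isSelfAdjoint_multiplier {R : H →L[ℂ] H} (hR : IsSelfAdjoint R)
    (N : Submodule ℂ H) [N.HasOrthogonalProjection] (hN : ∀ ν ∈ N, R ν = ν)
    {a : ℝ} (ha : 0 ≤ a) {b : EReal}
    (hspec : ∀ ω : ℂ, (∃ x : ℕ → H × H, (∀ n, (x n).1 = R ((x n).1 + (x n).2)) ∧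
      (∀ n, ‖(x n).1‖ = 1) ∧ (∀ n, (x n).1 ∈ Nᗮ) ∧
      Tendsto (fun n => ‖(x n).2 - (Complex.I * ω) • (x n).1‖) atTop (𝓝 0)) →
      ∃ r : ℝ, Complex.I * ω = r ∧ r ∈ {r : ℝ | a ≤ r ∧ (r : EReal) ≤ b})
    {M : H →L[ℂ] H} (hM : IsSelfAdjoint M) {c C : ℝ} (hc : 0 < c)
    (hMc : ∀ ψ, c * ‖ψ‖ ^ 2 ≤ (inner ℂ ψ (M ψ)).re)
    (hMC : ∀ ψ, (inner ℂ ψ (M ψ)).re ≤ C * ‖ψ‖ ^ 2)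
    {ω : ℂ} {x : ℕ → H × H} (hx : ∀ n, (x n).1 = R ((x n).1 + (x n).2))
    (hnorm : ∀ n, ‖(x n).1‖ = 1) (horth : ∀ n, M (x n).1 ∈ Nᗮ)
    (hlim : Tendsto (fun n => ‖(x n).2 - (Complex.I * ω) • M (x n).1‖) atTop (𝓝 0)) :
    ∃ r : ℝ, Complex.I * ω = r ∧ a / C ≤ r ∧ (r : EReal) ≤ b / (c : EReal) := by
  have hB : IsSelfAdjoint (R - N.starProjection) := hR.sub (isSelfAdjoint_starProjection N)
  have hmem := fun {μ : ℝ} => exists_eq_inv_sub_one_of_mem_spectrum hR N hN (μ := μ) hspec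
  have him : ∀ {S : H →L[ℂ] H}, IsSelfAdjoint S → ∀ y, (inner ℂ y (S y)).im = 0 := by
    intro S hS y
    rw [← Complex.conj_eq_iff_im, inner_conj_symm, ← ContinuousLinearMap.adjoint_inner_right,
      hS.adjoint_eq]
  -- $A\psi=h-Rh$ with $h=\psi+A\psi$, and $R$ is self-adjoint and fixes $N$.
  have hx2 : ∀ n, (x n).2 ∈ Nᗮ := by
    intro n
    rw [Submodule.mem_orthogonal]
    intro ν hν
    have h1 : (x n).2 = ((x n).1 + (x n).2) - R ((x n).1 + (x n).2) := by
      rw [← hx n, add_sub_cancel_left]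
    rw [h1, inner_sub_right, ← ContinuousLinearMap.adjoint_inner_left, hR.adjoint_eq, hN ν hν,
      sub_self]
  set ν : ℕ → H := fun n => N.starProjection (x n).1 with hν
  set φ : ℕ → H := fun n => (x n).1 - ν n with hφ
  have hνmem : ∀ n, ν n ∈ N := fun n => N.starProjection_apply_mem _
  have hψ : ∀ n, (x n).1 = φ n + ν n := fun n => (sub_add_cancel _ _).symm
  -- This makes $\varphi$ the vector $Bh$ of the quadratic-form bounds, with $h=\psi+A\psi$.
  have hφB : ∀ n, (R - N.starProjection) ((x n).1 + (x n).2) = φ n := by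
    intro n
    have h1 : N.starProjection (x n).2 = 0 := (N.starProjection_apply_eq_zero_iff).2 (hx2 n)
    rw [sub_apply, ← hx n, map_add, h1, add_zero]
  have hφmem : ∀ n, φ n ∈ Nᗮ := fun n => N.sub_starProjection_mem_orthogonal _
  have hφle : ∀ n, ‖φ n‖ ≤ 1 := by
    intro n
    have h1 : φ n = Nᗮ.starProjection (x n).1 := by
      rw [hφ]
      simp only
      rw [sub_eq_iff_eq_add', N.starProjection_add_starProjection_orthogonal]
    rw [h1, ← hnorm n]
    exact Nᗮ.norm_starProjection_apply_le _
  set q : ℕ → ℝ := fun n => (inner ℂ (x n).1 (x n).2).re with hq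
  set m : ℕ → ℝ := fun n => (inner ℂ (x n).1 (M (x n).1)).re with hm
  have hqφ : ∀ n, (inner ℂ (φ n) ((x n).1 + (x n).2)).re = ‖φ n‖ ^ 2 + q n := by
    intro n
    have h1 : inner ℂ (ν n) (x n).2 = 0 := (Submodule.mem_orthogonal _ _).1 (hx2 n) _ (hνmem n)
    have h2 : inner ℂ (φ n) (ν n) = 0 :=
      (Submodule.mem_orthogonal' _ _).1 (hφmem n) _ (hνmem n)
    have h3 : inner ℂ (φ n) (x n).2 = inner ℂ (x n).1 (x n).2 := by
      conv_rhs => rw [hψ n, inner_add_left, h1, add_zero]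
    have h4 : inner ℂ (φ n) (x n).1 = inner ℂ (φ n) (φ n) := by
      conv_lhs => rw [hψ n, inner_add_right, h2, add_zero]
    rw [inner_add_right, h3, h4, Complex.add_re]
    congr 1
    exact inner_self_eq_norm_sq (𝕜 := ℂ) (φ n)
  -- Multiplying $\mu^{-1}\ge1+a$ by $\mu^2$ gives $(1+a)\mu^2\le\mu$, which also holds at the point
  -- $\mu=0$ left out by the spectral comparison. The summand $1$ cancels the $\|\varphi\|^2$ in
  -- $(\varphi,\psi+A\psi)$.
  have hlow : ∀ n, a * ‖φ n‖ ^ 2 ≤ q n := by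
    intro n
    have h1 := mul_norm_sq_le_re_inner hB (c := 1 + a) (fun μ hμ => ?_) ((x n).1 + (x n).2)
    · rw [hφB, hqφ] at h1
      linarith
    · rcases eq_or_ne μ 0 with rfl | h0
      · simp
      · have h2 := (hmem hμ h0).1
        have h3 : μ = (μ⁻¹ - 1) * μ ^ 2 + μ ^ 2 := by field_simp; ring
        nlinarith [mul_le_mul_of_nonneg_right h2 (sq_nonneg μ)]
  have hup : ∀ b' : ℝ, b ≤ (b' : EReal) → ∀ n, q n ≤ b' * ‖φ n‖ ^ 2 := by
    intro b' hb n
    have h1 := re_inner_le_mul_norm_sq hB (c := 1 + b') (fun μ hμ => ?_) ((x n).1 + (x n).2)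
    · rw [hφB, hqφ] at h1
      linarith
    · rcases eq_or_ne μ 0 with rfl | h0
      · simp
      · have h2 : μ⁻¹ - 1 ≤ b' := EReal.coe_le_coe_iff.1 ((hmem hμ h0).2.trans hb)
        have h3 : μ = (μ⁻¹ - 1) * μ ^ 2 + μ ^ 2 := by field_simp; ring
        nlinarith [mul_le_mul_of_nonneg_right h2 (sq_nonneg μ)]
  have hmc : ∀ n, c ≤ m n := fun n => by simpa [hnorm n] using hMc (x n).1
  -- The decisive use of $M\psi\perp N$: the cross terms $(\nu,M\psi)$ and $(\psi,M\nu)$ vanish, so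
  -- passing from $\psi$ to $\varphi$ increases the form of $M$ by $(\nu,M\nu)\ge0$. The bound thus
  -- involves $\|\varphi\|$, which matches the lower bound on `q`.
  have hmC : ∀ n, m n ≤ C * ‖φ n‖ ^ 2 := by
    intro n
    have h1 : inner ℂ (ν n) (M (x n).1) = 0 :=
      (Submodule.mem_orthogonal _ _).1 (horth n) _ (hνmem n)
    have h2 : inner ℂ (x n).1 (M (ν n)) = 0 := by
      rw [← ContinuousLinearMap.adjoint_inner_left, hM.adjoint_eq, ← inner_conj_symm, h1, map_zero]
    have h3 : inner ℂ (φ n) (M (φ n)) =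
        inner ℂ (x n).1 (M (x n).1) + inner ℂ (ν n) (M (ν n)) := by
      simp only [hφ, map_sub, inner_sub_left, inner_sub_right, h1, h2]
      ring
    have h4 := hMC (φ n)
    have h5 := hMc (ν n)
    rw [h3, Complex.add_re] at h4
    have h6 : 0 ≤ c * ‖ν n‖ ^ 2 := by positivity
    linarith
  have hφpos : ∀ n, 0 < ‖φ n‖ ^ 2 := by
    intro n
    rcases (sq_nonneg ‖φ n‖).lt_or_eq with h | h
    · exact h
    · have h1 := hmC n
      rw [← h, mul_zero] at h1
      linarith [hmc n]
  have hCpos : 0 < C := by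
    by_contra hC
    nlinarith [hmC 0, hmc 0, hφpos 0]
  set ε : ℕ → ℂ := fun n => inner ℂ (x n).1 ((x n).2 - (Complex.I * ω) • M (x n).1) with hε
  have hεlim : Tendsto ε atTop (𝓝 0) := by
    rw [tendsto_zero_iff_norm_tendsto_zero]
    refine squeeze_zero (fun n => norm_nonneg _) (fun n => ?_) hlim
    have := norm_inner_le_norm (𝕜 := ℂ) (x n).1 ((x n).2 - (Complex.I * ω) • M (x n).1)
    rwa [hnorm n, one_mul] at this
  have hqim : ∀ n, (inner ℂ (x n).1 (x n).2).im = 0 := by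
    intro n
    have h1 := him hR ((x n).1 + (x n).2)
    rw [← hx n, ← inner_conj_symm, inner_add_right, map_add, inner_conj_symm, Complex.add_im] at h1
    have h2 : (inner ℂ (x n).1 (x n).1).im = 0 := inner_self_im (𝕜 := ℂ) (x n).1
    rw [h2, zero_add, Complex.conj_im] at h1
    linarith
  have hεeq : ∀ n, ε n = (q n : ℂ) - Complex.I * ω * (m n : ℂ) := by
    intro n
    have h1 : inner ℂ (x n).1 (x n).2 = (q n : ℂ) := Complex.ext rfl (by simpa using hqim n)
    have h2 : inner ℂ (x n).1 (M (x n).1) = (m n : ℂ) :=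
      Complex.ext rfl (by simpa using him hM (x n).1)
    rw [hε]
    simp only
    rw [inner_sub_right, inner_smul_right, h1, h2]
  -- In $\varepsilon_n=q_n-i\omega m_n\to0$ both `q n` and `m n` are real, and $m_n\ge c>0$.
  have hωim : (Complex.I * ω).im = 0 := by
    have h1 : Tendsto (fun n => |(ε n).im|) atTop (𝓝 0) := by
      simpa using ((Complex.continuous_im.tendsto _).comp hεlim).abs
    have h2 : |(Complex.I * ω).im| * c ≤ 0 := by
      refine ge_of_tendsto h1 (Eventually.of_forall fun n => ?_)
      rw [hεeq, Complex.sub_im, Complex.im_mul_ofReal, Complex.ofReal_im, zero_sub, abs_neg,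
        abs_mul]
      exact mul_le_mul_of_nonneg_left ((hmc n).trans (le_abs_self _)) (abs_nonneg _)
    have h3 : |(Complex.I * ω).im| ≤ 0 := nonpos_of_mul_nonpos_left h2 hc
    exact abs_eq_zero.1 (le_antisymm h3 (abs_nonneg _))
  set r : ℝ := (Complex.I * ω).re with hr
  have hωr : Complex.I * ω = (r : ℂ) := Complex.ext rfl (by simpa using hωim)
  have hrelim : Tendsto (fun n => q n - r * m n) atTop (𝓝 0) := by
    have h1 := (Complex.continuous_re.tendsto _).comp hεlim
    rw [Complex.zero_re] at h1
    refine h1.congr fun n => ?_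
    simp only [Function.comp_def]
    rw [hεeq, hωr, ← Complex.ofReal_mul, ← Complex.ofReal_sub, Complex.ofReal_re]
  refine ⟨r, hωr, ?_, ?_⟩
  · by_contra hlt
    push Not at hlt
    have h1 : (a / C - r) * c ≤ 0 := by
      refine ge_of_tendsto hrelim (Eventually.of_forall fun n => ?_)
      have h2 : a / C * m n ≤ a * ‖φ n‖ ^ 2 := by
        rw [div_mul_eq_mul_div, div_le_iff₀ hCpos, mul_assoc]
        exact mul_le_mul_of_nonneg_left (by linarith [hmC n]) ha
      have h3 := mul_le_mul_of_nonneg_left (hmc n) (sub_nonneg.2 hlt.le)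
      linarith [hlow n]
    nlinarith
  -- The case $b=-\infty$ contradicts $q\ge a\|\varphi\|^2\ge0$ with $\varphi\ne0$. For real $b$ the
  -- same argument gives $b\ge0$, and then $q\le b\|\varphi\|^2\le b\le(b/c)m$.
  · induction b with
    | bot =>
      have h1 := hup (-1) bot_le 0
      have h2 := hlow 0
      nlinarith [hφpos 0]
    | top =>
      rw [EReal.top_div_of_pos_ne_top (by exact_mod_cast hc) (EReal.coe_ne_top _)]
      exact le_top
    | coe b =>
      rw [← EReal.coe_div, EReal.coe_le_coe_iff]
      by_contra hlt
      push Not at hlt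
      have hb : 0 ≤ b := by
        by_contra hb
        nlinarith [hup b le_rfl 0, hlow 0, hφpos 0]
      have h1 : (r - b / c) * c ≤ 0 := by
        have h0 : Tendsto (fun n => r * m n - q n) atTop (𝓝 0) := by
          simpa using hrelim.neg
        refine ge_of_tendsto h0 (Eventually.of_forall fun n => ?_)
        have h2 : b * ‖φ n‖ ^ 2 ≤ b / c * m n := by
          rw [div_mul_eq_mul_div, le_div_iff₀ hc, mul_assoc]
          refine mul_le_mul_of_nonneg_left ?_ hb
          have h5 : ‖φ n‖ ^ 2 ≤ 1 := pow_le_one₀ (norm_nonneg _) (hφle n)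
          nlinarith [hmc n]
        have h3 := mul_le_mul_of_nonneg_left (hmc n) (sub_nonneg.2 hlt.le)
        linarith [hup b le_rfl n]
      nlinarith

end Comparison

/-! ### Two-body kinematics and the center-of-mass parametrization -/

section Kinematics

theorem minkowski_fourMomentum (m : ℝ) (p q : Momentum) :
    minkowski (fourMomentum m p) (fourMomentum m q) =
      -(energy m p * energy m q) + inner ℝ p q := by
  simp [minkowski, fourMomentum, PiLp.inner_apply, mul_comm]

theorem energy_nonneg (m : ℝ) (p : Momentum) : 0 ≤ energy m p := Real.sqrt_nonneg _

theorem energy_sq (m : ℝ) (p : Momentum) : energy m p ^ 2 = m ^ 2 + ‖p‖ ^ 2 :=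
  Real.sq_sqrt (by positivity)

theorem norm_le_energy (m : ℝ) (p : Momentum) : ‖p‖ ≤ energy m p :=
  Real.le_sqrt_of_sq_le (by nlinarith [sq_nonneg m])

theorem energy_pos (m : ℝ) {p : Momentum} (hp : p ≠ 0) : 0 < energy m p :=
  (norm_pos_iff.2 hp).trans_le (norm_le_energy m p)

theorem energy_eq_of_norm_eq (m : ℝ) {p q : Momentum} (h : ‖p‖ = ‖q‖) :
    energy m p = energy m q := by rw [energy, energy, h]

theorem mandelstamS_eq (m : ℝ) (p q : Momentum) :
    mandelstamS m p q = (energy m p + energy m q) ^ 2 - ‖p + q‖ ^ 2 := by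
  have h : ‖p + q‖ ^ 2 = ∑ j : Fin 3, (p j + q j) * (p j + q j) := by
    rw [EuclideanSpace.norm_sq_eq]
    simp [Real.norm_eq_abs, pow_two]
  rw [h]
  simp [mandelstamS, minkowski, fourMomentum, pow_two]
  ring

theorem mandelstamS_eq_two_mul (m : ℝ) (p q : Momentum) :
    mandelstamS m p q =
      2 * (m ^ 2 - minkowski (fourMomentum m p) (fourMomentum m q)) := by
  rw [mandelstamS_eq, minkowski_fourMomentum, norm_add_sq_real, add_sq, energy_sq, energy_sq]
  ring

theorem mandelstamS_nonneg (m : ℝ) (p q : Momentum) : 0 ≤ mandelstamS m p q := by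
  rw [mandelstamS_eq, sub_nonneg]
  have := (norm_add_le p q).trans (add_le_add (norm_le_energy m p) (norm_le_energy m q))
  gcongr

/-- With $s=2(m^2-p\cdot q)$, the difference $(p\cdot q)^2-m^4$ factors as $s(s/4-m^2)$. Hence a
nonzero Møller velocity forces $s>0$ and $s>4m^2$, which is what a center-of-mass frame with nonzero
relative momentum requires. -/
theorem mollerVelocity_eq (m : ℝ) (p q : Momentum) :
    mollerVelocity m p q =
      √(mandelstamS m p q * (mandelstamS m p q / 4 - m ^ 2)) / (energy m p * energy m q) := by
  rw [mollerVelocity, mandelstamS_eq_two_mul]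
  congr 2
  ring

theorem mollerVelocity_nonneg (m : ℝ) (p q : Momentum) : 0 ≤ mollerVelocity m p q :=
  div_nonneg (Real.sqrt_nonneg _) (mul_nonneg (energy_nonneg _ _) (energy_nonneg _ _))

theorem mandelstamS_comm (m : ℝ) (p q : Momentum) : mandelstamS m p q = mandelstamS m q p := by
  rw [mandelstamS_eq, mandelstamS_eq, add_comm p, add_comm (energy m p)]

theorem mollerVelocity_comm (m : ℝ) (p q : Momentum) :
    mollerVelocity m p q = mollerVelocity m q p := by
  rw [mollerVelocity_eq, mollerVelocity_eq, mandelstamS_comm, mul_comm (energy m p)]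

/-- The total energy of two particles of opposite center-of-mass momenta `± k`, seen from the frame
in which their total momentum is `P`. -/
noncomputable def pairEnergy (m : ℝ) (P k : Momentum) : ℝ :=
  √((2 * energy m k) ^ 2 + ‖P‖ ^ 2)

/-- The momentum of a particle of center-of-mass momentum `k` in the frame in which the total
momentum of the pair is `P`. -/
noncomputable def pairBoost (m : ℝ) (P k : Momentum) : Momentum :=
  (1 / 2 : ℝ) • P + k +
    (inner ℝ P k / (2 * energy m k * (pairEnergy m P k + 2 * energy m k))) • P

theorem pairEnergy_sq (m : ℝ) (P k : Momentum) :
    pairEnergy m P k ^ 2 = (2 * energy m k) ^ 2 + ‖P‖ ^ 2 := Real.sq_sqrt (by positivity)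

theorem pairEnergy_nonneg (m : ℝ) (P k : Momentum) : 0 ≤ pairEnergy m P k := Real.sqrt_nonneg _

theorem pairEnergy_pos (m : ℝ) (P : Momentum) {k : Momentum} (hk : k ≠ 0) :
    0 < pairEnergy m P k :=
  Real.sqrt_pos.2 (by have := energy_pos m hk; positivity)

theorem pairEnergy_eq_of_norm_eq (m : ℝ) (P : Momentum) {k l : Momentum} (h : ‖k‖ = ‖l‖) :
    pairEnergy m P k = pairEnergy m P l := by
  rw [pairEnergy, pairEnergy, energy_eq_of_norm_eq m h]

/-- The partner is the boost of the opposite center-of-mass momentum. -/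
theorem sub_pairBoost (m : ℝ) (P k : Momentum) :
    P - pairBoost m P k = pairBoost m P (-k) := by
  rw [pairBoost, pairBoost, energy_eq_of_norm_eq m (norm_neg k),
    pairEnergy_eq_of_norm_eq m P (norm_neg k), inner_neg_right]
  module

theorem energy_pairBoost (m : ℝ) (P : Momentum) {k : Momentum} (hk : k ≠ 0) :
    energy m (pairBoost m P k) = pairEnergy m P k / 2 + inner ℝ P k / (2 * energy m k) := by
  have hε := energy_pos m hk
  have hE := pairEnergy_pos m P hk
  have hE2 := pairEnergy_sq m P k
  have hε2 := energy_sq m k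
  have hx := abs_le.1 (abs_real_inner_le_norm P k)
  have hPE : ‖P‖ ≤ pairEnergy m P k := Real.le_sqrt_of_sq_le (by nlinarith)
  have hk1 := norm_le_energy m k
  set E := pairEnergy m P k with hEdef
  set ε := energy m k with hεdef
  set x : ℝ := inner ℝ P k with hxdef
  have hnn : 0 ≤ E / 2 + x / (2 * ε) := by
    have : -(E * ε) ≤ x := by
      have : ‖P‖ * ‖k‖ ≤ E * ε := by gcongr
      linarith [hx.1]
    have h2 : E / 2 + x / (2 * ε) = (E * ε + x) / (2 * ε) := by field_simp
    rw [h2]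
    exact div_nonneg (by linarith) (by linarith)
  rw [energy, ← Real.sqrt_sq hnn]
  congr 1
  have hg : pairBoost m P k = ((1 / 2 : ℝ) + x / (2 * ε * (E + 2 * ε))) • P + k := by
    rw [pairBoost]
    module
  have hP2 : ‖P‖ ^ 2 = E ^ 2 - (2 * ε) ^ 2 := by linarith
  have hk2 : ‖k‖ ^ 2 = ε ^ 2 - m ^ 2 := by linarith
  rw [hg, norm_add_sq_real, norm_smul, inner_smul_left, mul_pow, hP2, hk2, Real.norm_eq_abs,
    sq_abs, ← hxdef]
  simp only [conj_trivial]
  have hsum : E + 2 * ε ≠ 0 := by positivity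
  field_simp
  ring

/-- For $m=0$ an energy vanishes at zero momentum; this is excluded here because $k\ne0$ makes the
total momentum strictly timelike, $\|P\|<E$. -/
theorem energy_pairBoost_pos (m : ℝ) (P : Momentum) {k : Momentum} (hk : k ≠ 0) :
    0 < energy m (pairBoost m P k) := by
  have hε := energy_pos m hk
  have hPE : ‖P‖ < pairEnergy m P k := by
    refine lt_of_pow_lt_pow_left₀ 2 (pairEnergy_nonneg _ _ _) ?_
    rw [pairEnergy_sq]
    exact lt_add_of_pos_left _ (by positivity)
  have hx := (abs_le.1 (abs_real_inner_le_norm P k)).1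
  have h : ‖P‖ * ‖k‖ < pairEnergy m P k * energy m k :=
    (mul_le_mul_of_nonneg_left (norm_le_energy m k) (norm_nonneg P)).trans_lt
      (mul_lt_mul_of_pos_right hPE hε)
  rw [energy_pairBoost m P hk]
  have h2 : pairEnergy m P k / 2 + inner ℝ P k / (2 * energy m k) =
      (pairEnergy m P k * energy m k + inner ℝ P k) / (2 * energy m k) := by field_simp
  rw [h2]
  exact div_pos (by linarith) (by linarith)

theorem energy_sub_pairBoost (m : ℝ) (P : Momentum) {k : Momentum} (hk : k ≠ 0) :
    energy m (P - pairBoost m P k) =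
      pairEnergy m P k / 2 - inner ℝ P k / (2 * energy m k) := by
  rw [sub_pairBoost, energy_pairBoost m P (neg_ne_zero.2 hk),
    energy_eq_of_norm_eq m (norm_neg k), pairEnergy_eq_of_norm_eq m P (norm_neg k),
    inner_neg_right, neg_div, sub_eq_add_neg]

theorem energy_pairBoost_add (m : ℝ) (P : Momentum) {k : Momentum} (hk : k ≠ 0) :
    energy m (pairBoost m P k) + energy m (P - pairBoost m P k) = pairEnergy m P k := by
  rw [energy_pairBoost m P hk, energy_sub_pairBoost m P hk]
  ring

theorem mandelstamS_pairBoost (m : ℝ) (P : Momentum) {k : Momentum} (hk : k ≠ 0) :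
    mandelstamS m (pairBoost m P k) (P - pairBoost m P k) = (2 * energy m k) ^ 2 := by
  rw [mandelstamS_eq, energy_pairBoost_add m P hk, add_sub_cancel, pairEnergy_sq]
  ring

theorem mollerVelocity_pairBoost (m : ℝ) (P : Momentum) {k : Momentum} (hk : k ≠ 0) :
    mollerVelocity m (pairBoost m P k) (P - pairBoost m P k) =
      2 * energy m k * ‖k‖ /
        (energy m (pairBoost m P k) * energy m (P - pairBoost m P k)) := by
  rw [mollerVelocity_eq, mandelstamS_pairBoost m P hk]
  congr 1
  rw [← Real.sqrt_sq (mul_nonneg (mul_nonneg zero_le_two (energy_nonneg m k)) (norm_nonneg k))]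
  congr 1
  have := energy_sq m k
  rw [mul_pow _ ‖k‖, show ‖k‖ ^ 2 = energy m k ^ 2 - m ^ 2 by linarith]
  ring

theorem outgoing_pairBoost (m : ℝ) (P : Momentum) {k : Momentum} (hk : k ≠ 0)
    {ω : Momentum} (hω : ‖ω‖ = 1) :
    outgoing m (pairBoost m P k) (P - pairBoost m P k) ω = pairBoost m P (‖k‖ • ω) := by
  have hn : ‖‖k‖ • ω‖ = ‖k‖ := by rw [norm_smul, norm_norm, hω, mul_one]
  have hκ : √(mandelstamS m (pairBoost m P k) (P - pairBoost m P k) - 4 * m ^ 2) / 2 = ‖k‖ := by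
    rw [mandelstamS_pairBoost m P hk, mul_pow, energy_sq,
      show (2 : ℝ) ^ 2 * (m ^ 2 + ‖k‖ ^ 2) - 4 * m ^ 2 = (2 * ‖k‖) ^ 2 by ring,
      Real.sqrt_sq (by positivity)]
    ring
  have hW : √(mandelstamS m (pairBoost m P k) (P - pairBoost m P k)) = 2 * energy m k := by
    rw [mandelstamS_pairBoost m P hk, Real.sqrt_sq (by have := energy_nonneg m k; positivity)]
  rw [outgoing, hκ, hW, energy_pairBoost_add m P hk, add_sub_cancel, pairBoost,
    energy_eq_of_norm_eq m hn, pairEnergy_eq_of_norm_eq m P hn, inner_smul_right]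
  module

theorem inner_pairBoost (m : ℝ) (P : Momentum) {k : Momentum} (hk : k ≠ 0) :
    inner ℝ P (pairBoost m P k - (1 / 2 : ℝ) • P) =
      inner ℝ P k * pairEnergy m P k / (2 * energy m k) := by
  have hε := energy_pos m hk
  have hE := pairEnergy_pos m P hk
  have hP2 : ‖P‖ ^ 2 = pairEnergy m P k ^ 2 - (2 * energy m k) ^ 2 := by
    linarith [pairEnergy_sq m P k]
  have hsum : pairEnergy m P k + 2 * energy m k ≠ 0 := by positivity
  rw [pairBoost, add_assoc, add_sub_cancel_left, inner_add_right, inner_smul_right,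
    real_inner_self_eq_norm_sq, hP2]
  field_simp
  ring

/-- The image determines in turn the total energy, the invariant $s$ (hence the energy of $k$) and
$P\cdot k$. These fix every term of the boost except $k$ itself. -/
theorem injOn_pairBoost (m : ℝ) (P : Momentum) : Set.InjOn (pairBoost m P) {0}ᶜ := by
  intro k hk l hl h
  have hk : k ≠ 0 := hk
  have hl : l ≠ 0 := hl
  have hE : pairEnergy m P k = pairEnergy m P l := by
    rw [← energy_pairBoost_add m P hk, ← energy_pairBoost_add m P hl, h]
  have hε : energy m k = energy m l := by
    have h1 := mandelstamS_pairBoost m P hk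
    rw [h, mandelstamS_pairBoost m P hl] at h1
    have h2 := energy_nonneg m k
    have h3 := energy_nonneg m l
    nlinarith [energy_pos m hk, energy_pos m hl]
  have hx : (inner ℝ P k : ℝ) = inner ℝ P l := by
    have h1 := inner_pairBoost m P hk
    rw [h, inner_pairBoost m P hl, hE, hε] at h1
    have h2 := energy_pos m hl
    have h3 := pairEnergy_pos m P hl
    field_simp at h1
    exact h1.symm
  rw [pairBoost, pairBoost, hE, hε, hx] at h
  exact add_left_cancel (add_right_cancel h)

theorem exists_pairBoost_eq {m : ℝ} {p q : Momentum} (h : mollerVelocity m p q ≠ 0) :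
    ∃ k : Momentum, k ≠ 0 ∧ pairBoost m (p + q) k = p := by
  have hs0 := mandelstamS_nonneg m p q
  have hpos : 0 < mandelstamS m p q * (mandelstamS m p q / 4 - m ^ 2) := by
    by_contra hle
    exact h (by rw [mollerVelocity_eq, Real.sqrt_eq_zero_of_nonpos (not_lt.1 hle), zero_div])
  have hs : 0 < mandelstamS m p q := by
    rcases hs0.lt_or_eq with h1 | h1
    · exact h1
    · rw [← h1] at hpos
      simp at hpos
  have hκ : 0 < mandelstamS m p q / 4 - m ^ 2 := (pos_iff_pos_of_mul_pos hpos).1 hs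
  have hsE := mandelstamS_eq m p q
  set s := mandelstamS m p q with hsdef
  set W := √s with hW
  set E := energy m p + energy m q with hE
  have hWpos : 0 < W := Real.sqrt_pos.2 hs
  have hW2 : W ^ 2 = s := Real.sq_sqrt hs0
  have hE0 : 0 ≤ E := add_nonneg (energy_nonneg _ _) (energy_nonneg _ _)
  have hEpos : 0 < E := by
    rcases hE0.lt_or_eq with h1 | h1
    · exact h1
    · rw [← h1] at hsE
      nlinarith [sq_nonneg ‖p + q‖]
  have hsum : E + W ≠ 0 := by positivity
  obtain ⟨d, hd⟩ : ∃ d : Momentum, d = (1 / 2 : ℝ) • (p - q) := ⟨_, rfl⟩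
  set x : ℝ := inner ℝ (p + q) d with hx
  have hP2 : ‖p + q‖ ^ 2 = E ^ 2 - W ^ 2 := by rw [hW2]; linarith
  have hxE : x = E * (energy m p - energy m q) / 2 := by
    have h1 : x = (‖p‖ ^ 2 - ‖q‖ ^ 2) / 2 := by
      rw [hx, hd, inner_smul_right, inner_add_left, inner_sub_right, inner_sub_right,
        real_inner_self_eq_norm_sq, real_inner_self_eq_norm_sq, real_inner_comm p q]
      ring
    rw [h1, hE]
    linarith [energy_sq m p, energy_sq m q]
  have hd2 : ‖d‖ ^ 2 = s / 4 - m ^ 2 + (energy m p - energy m q) ^ 2 / 4 := by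
    have h1 : ‖d‖ ^ 2 = ‖p - q‖ ^ 2 / 4 := by
      rw [hd, norm_smul, mul_pow, Real.norm_eq_abs, sq_abs]; ring
    have h2 : ‖p - q‖ ^ 2 = 2 * (‖p‖ ^ 2 + ‖q‖ ^ 2) - ‖p + q‖ ^ 2 := by
      rw [norm_sub_sq_real, norm_add_sq_real]; ring
    rw [h1, h2, hsE, hE]
    linarith [energy_sq m p, energy_sq m q]
  -- The inverse boost of the half relative momentum `d`, from the frame of total energy `E` to that
  -- of invariant mass `W`.
  set k : Momentum := d - (x / (E * (E + W))) • (p + q) with hk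
  have hk2 : ‖k‖ ^ 2 = s / 4 - m ^ 2 := by
    have h1 : ‖k‖ ^ 2 = ‖d‖ ^ 2 - x ^ 2 / E ^ 2 := by
      rw [hk, norm_sub_sq_real, norm_smul, inner_smul_right, mul_pow, hP2, Real.norm_eq_abs,
        sq_abs, real_inner_comm, ← hx]
      field_simp
      ring
    rw [h1, hd2, hxE]
    field_simp
    ring
  have hεk : 2 * energy m k = W := by
    rw [energy, hk2, hW, show m ^ 2 + (s / 4 - m ^ 2) = s / 2 ^ 2 by ring, Real.sqrt_div hs0,
      Real.sqrt_sq zero_le_two]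
    ring
  have hEk : pairEnergy m (p + q) k = E := by
    rw [pairEnergy, hεk, hP2, add_sub_cancel, Real.sqrt_sq hE0]
  refine ⟨k, fun h0 => ?_, ?_⟩
  · rw [h0, norm_zero] at hk2
    linarith
  · have hxk : (inner ℝ (p + q) k : ℝ) = x * W / E := by
      rw [hk, inner_sub_right, inner_smul_right, real_inner_self_eq_norm_sq, hP2, ← hx]
      field_simp
      ring
    have hc : (inner ℝ (p + q) k : ℝ) / (W * (E + W)) = x / (E * (E + W)) := by
      rw [hxk]
      field_simp
    rw [pairBoost, hεk, hEk, hc, hk, hd]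
    module

end Kinematics

/-! ### The Jacobian of the center-of-mass parametrization -/

section Jacobian

/-- The boost coefficient depends on $k$ only through $t=m^2+\|k\|^2$, which is smooth in $k$. -/
theorem hasDerivAt_boostCoefficient (b : ℝ) {t : ℝ} (ht : 0 < t) :
    HasDerivAt (fun t => (2 * √t * (√((2 * √t) ^ 2 + b ^ 2) + 2 * √t))⁻¹)
      (-2 / (√((2 * √t) ^ 2 + b ^ 2) * (2 * √t) ^ 3)) t := by
  have hw : HasDerivAt (fun t : ℝ => 2 * √t) (2 * (1 / (2 * √t))) t :=
    (Real.hasDerivAt_sqrt ht.ne').const_mul 2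
  have hs := Real.sqrt_pos.2 ht
  have hpos : 0 < (2 * √t) ^ 2 + b ^ 2 := by positivity
  have hE := ((hw.pow 2).add_const (b ^ 2)).sqrt hpos.ne'
  have hEpos := Real.sqrt_pos.2 hpos
  have hE2 := Real.sq_sqrt hpos.le
  have hD := (hw.mul (hE.add hw)).inv (by
    have : 0 < √((2 * √t) ^ 2 + b ^ 2) + 2 * √t := by positivity
    simp only [Pi.mul_apply, Pi.add_apply, Pi.pow_apply]
    positivity)
  refine hD.congr_deriv ?_
  simp only [Pi.mul_apply, Pi.add_apply, Pi.pow_apply]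
  set W := √t
  set E := √((2 * W) ^ 2 + b ^ 2)
  have hsum : E + 2 * W ≠ 0 := by positivity
  field_simp
  ring

/-- The derivative of the boost of a pair with respect to the center-of-mass momentum, minus the
identity, as a functional multiplying the total momentum. -/
noncomputable def pairBoostDual (m : ℝ) (P k : Momentum) : Momentum →L[ℝ] ℝ :=
  (2 * energy m k * (pairEnergy m P k + 2 * energy m k))⁻¹ • innerSL ℝ P +
    (inner ℝ P k * (-4 / (pairEnergy m P k * (2 * energy m k) ^ 3))) • innerSL ℝ k

theorem hasFDerivAt_pairBoost (m : ℝ) (P : Momentum) {k : Momentum} (hk : k ≠ 0) :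
    HasFDerivAt (pairBoost m P)
      (ContinuousLinearMap.id ℝ Momentum + (pairBoostDual m P k).smulRight P) k := by
  have hn : HasFDerivAt (fun k : Momentum => m ^ 2 + ‖k‖ ^ 2) (2 • innerSL ℝ k) k :=
    (hasStrictFDerivAt_norm_sq k).hasFDerivAt.const_add (m ^ 2)
  have ht : 0 < m ^ 2 + ‖k‖ ^ 2 := by have := norm_pos_iff.2 hk; positivity
  have hc := (hasDerivAt_boostCoefficient ‖P‖ ht).comp_hasFDerivAt k hn
  have hi : HasFDerivAt (fun k : Momentum => (inner ℝ P k : ℝ)) (innerSL ℝ P) k :=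
    (innerSL ℝ P).hasFDerivAt
  have h := ((hasFDerivAt_id k).const_add ((1 / 2 : ℝ) • P)).add ((hi.mul hc).smul_const P)
  refine h.congr_fderiv ?_
  ext v : 1
  simp only [pairBoostDual, pairEnergy, energy, add_apply, smul_apply,
    ContinuousLinearMap.smulRight_apply, Function.comp_apply, smul_eq_mul, nsmul_eq_mul]
  congr 2
  push_cast
  ring

/-- The derivative is a rank-one perturbation of the identity, with determinant $1+\ell(P)$. The
product of the two particle energies is exactly what the Møller velocity has in its denominator. -/
theorem det_fderiv_pairBoost (m : ℝ) (P : Momentum) {k : Momentum} (hk : k ≠ 0) :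
    (ContinuousLinearMap.id ℝ Momentum + (pairBoostDual m P k).smulRight P).det =
      4 * (energy m (pairBoost m P k) * energy m (P - pairBoost m P k)) /
        (pairEnergy m P k * (2 * energy m k)) := by
  have h1 : (ContinuousLinearMap.id ℝ Momentum + (pairBoostDual m P k).smulRight P).det =
      1 + pairBoostDual m P k P :=
    LinearMap.transvection.det (pairBoostDual m P k : Momentum →ₗ[ℝ] ℝ) P
  have hε := energy_pos m hk
  have hE := pairEnergy_pos m P hk
  have hP2 : ‖P‖ ^ 2 = pairEnergy m P k ^ 2 - (2 * energy m k) ^ 2 := by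
    linarith [pairEnergy_sq m P k]
  have hsum : pairEnergy m P k + 2 * energy m k ≠ 0 := by positivity
  rw [h1, energy_pairBoost m P hk, energy_sub_pairBoost m P hk]
  simp only [pairBoostDual, add_apply, smul_apply, innerSL_apply_apply, smul_eq_mul,
    real_inner_self_eq_norm_sq, real_inner_comm P k, hP2]
  field_simp
  ring

theorem measurable_energy (m : ℝ) : Measurable (energy m) := by
  unfold energy; fun_prop

theorem measurable_minkowski : Measurable fun x : (Fin 4 → ℝ) × (Fin 4 → ℝ) =>
    minkowski x.1 x.2 := by
  unfold minkowski; fun_prop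

theorem measurable_fourMomentum (m : ℝ) : Measurable (fourMomentum m) := by
  refine measurable_pi_lambda _ fun μ => ?_
  refine Fin.cases ?_ (fun j => ?_) μ
  · simpa [fourMomentum] using measurable_energy m
  · simp only [fourMomentum, Fin.cons_succ]
    fun_prop

theorem measurable_mandelstamS (m : ℝ) : Measurable fun x : Momentum × Momentum =>
    mandelstamS m x.1 x.2 := by
  have := measurable_energy m
  simp only [mandelstamS_eq]
  fun_prop

theorem measurable_mollerVelocity (m : ℝ) : Measurable fun x : Momentum × Momentum =>
    mollerVelocity m x.1 x.2 := by
  have := measurable_energy m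
  have := measurable_mandelstamS m
  simp only [mollerVelocity_eq]
  fun_prop

theorem measurable_outgoing (m : ℝ) : Measurable fun x : Momentum × Momentum × Momentum =>
    outgoing m x.1 x.2.1 x.2.2 := by
  have := measurable_energy m
  have h : Measurable fun x : Momentum × Momentum × Momentum => mandelstamS m x.1 x.2.1 :=
    (measurable_mandelstamS m).comp (f := fun x : Momentum × Momentum × Momentum => (x.1, x.2.1))
      (by fun_prop)
  unfold outgoing
  fun_prop

theorem measurable_pairEnergy (m : ℝ) (P : Momentum) : Measurable (pairEnergy m P) := by
  have := measurable_energy m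
  unfold pairEnergy
  fun_prop

theorem measurable_pairBoost (m : ℝ) (P : Momentum) : Measurable (pairBoost m P) := by
  have := measurable_energy m
  have := measurable_pairEnergy m P
  unfold pairBoost
  fun_prop

/-- Passing to the center-of-mass momentum at fixed total momentum. -/
theorem lintegral_mollerVelocity_mul (m : ℝ) (P : Momentum) (F : Momentum → ℝ≥0∞) :
    ∫⁻ p, ENNReal.ofReal (mollerVelocity m p (P - p)) * F p =
      ∫⁻ k, ENNReal.ofReal (4 * ‖k‖ / pairEnergy m P k) * F (pairBoost m P k) := by
  -- The momenta missed by the parametrization are those at which the integrand on the left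
  -- vanishes.
  have himage : pairBoost m P '' {0}ᶜ = {p | mollerVelocity m p (P - p) ≠ 0} := by
    ext p
    constructor
    · rintro ⟨k, hk, rfl⟩
      have hk : k ≠ 0 := hk
      have h1 := energy_pos m hk
      have h2 := norm_pos_iff.2 hk
      have h3 := energy_pairBoost_pos m P hk
      have h4 := energy_pairBoost_pos m P (neg_ne_zero.2 hk)
      rw [Set.mem_ofPred_eq, mollerVelocity_pairBoost m P hk, sub_pairBoost]
      positivity
    · intro hp
      obtain ⟨k, hk, h⟩ := exists_pairBoost_eq hp
      rw [add_sub_cancel] at h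
      exact ⟨k, hk, h⟩
  have hmeas : MeasurableSet {p | mollerVelocity m p (P - p) ≠ 0} :=
    ((measurable_mollerVelocity m).comp (f := fun p => (p, P - p)) (by fun_prop)
      (measurableSet_singleton 0)).compl
  have h0 : MeasurableSet ({0}ᶜ : Set Momentum) := (measurableSet_singleton 0).compl
  have hae : (volume : Measure Momentum).restrict {0}ᶜ = volume :=
    Measure.restrict_eq_self_of_ae_mem (by
      simp [ae_iff])
  calc ∫⁻ p, ENNReal.ofReal (mollerVelocity m p (P - p)) * F p
      = ∫⁻ p in pairBoost m P '' {0}ᶜ, ENNReal.ofReal (mollerVelocity m p (P - p)) * F p := by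
        rw [himage, ← lintegral_indicator hmeas]
        refine lintegral_congr fun p => ?_
        by_cases hp : mollerVelocity m p (P - p) = 0
        · simp [hp]
        · rw [Set.indicator_of_mem (by exact hp)]
    _ = ∫⁻ k in {0}ᶜ, ENNReal.ofReal |(ContinuousLinearMap.id ℝ Momentum +
          (pairBoostDual m P k).smulRight P).det| *
          (ENNReal.ofReal (mollerVelocity m (pairBoost m P k) (P - pairBoost m P k)) *
            F (pairBoost m P k)) :=
        lintegral_image_eq_lintegral_abs_det_fderiv_mul volume h0
          (fun k hk => (hasFDerivAt_pairBoost m P hk).hasFDerivWithinAt) (injOn_pairBoost m P) _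
    _ = ∫⁻ k in {0}ᶜ, ENNReal.ofReal (4 * ‖k‖ / pairEnergy m P k) * F (pairBoost m P k) := by
        refine setLIntegral_congr_fun h0 fun k hk => ?_
        have hk : k ≠ 0 := hk
        simp only
        rw [← mul_assoc, ← ENNReal.ofReal_mul (abs_nonneg _)]
        congr 2
        have h1 := energy_pos m hk
        have h2 := pairEnergy_pos m P hk
        have h3 := energy_pairBoost_pos m P hk
        have h4 := energy_pairBoost_pos m P (neg_ne_zero.2 hk)
        rw [← sub_pairBoost] at h4
        rw [det_fderiv_pairBoost m P hk, mollerVelocity_pairBoost m P hk,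
          abs_of_nonneg (by positivity)]
        field_simp
    _ = _ := by rw [hae]

end Jacobian

/-! ### Microscopic reversibility -/

section CollisionSymmetry

theorem lintegral_polar {F : Momentum → ℝ≥0∞} (hF : Measurable F) :
    ∫⁻ k, F k = ∫⁻ r : Set.Ioi (0 : ℝ), ∫⁻ ω : Direction, F ((r : ℝ) • (ω : Momentum))
      ∂(volume : Measure Momentum).toSphere ∂Measure.volumeIoiPow 2 := by
  have hmp := (volume : Measure Momentum).measurePreserving_homeomorphUnitSphereProd
  have h0 : MeasurableSet ({0}ᶜ : Set Momentum) := (measurableSet_singleton 0).compl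
  have hae : (volume : Measure Momentum).restrict {0}ᶜ = volume :=
    Measure.restrict_eq_self_of_ae_mem (by simp [ae_iff])
  have hdim : Module.finrank ℝ Momentum - 1 = 2 := by simp
  rw [hdim] at hmp
  have hsymm : Measurable fun z : Direction × Set.Ioi (0 : ℝ) =>
      F ((z.2 : ℝ) • (z.1 : Momentum)) := by fun_prop
  calc ∫⁻ k, F k = ∫⁻ k in {0}ᶜ, F k := by rw [hae]
    _ = ∫⁻ k : ({0}ᶜ : Set Momentum), F k ∂(volume.comap Subtype.val) :=
        (lintegral_subtype_comap h0 F).symm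
    _ = ∫⁻ k : ({0}ᶜ : Set Momentum), (fun z : Direction × Set.Ioi (0 : ℝ) =>
          F ((z.2 : ℝ) • (z.1 : Momentum))) (homeomorphUnitSphereProd Momentum k)
          ∂(volume.comap Subtype.val) := by
        refine lintegral_congr fun k => ?_
        have h1 : ‖(k : Momentum)‖ ≠ 0 := norm_ne_zero_iff.2 k.2
        simp [smul_smul, h1]
    _ = ∫⁻ z, F ((z.2 : ℝ) • (z.1 : Momentum))
          ∂((volume : Measure Momentum).toSphere.prod (Measure.volumeIoiPow 2)) :=
        hmp.lintegral_comp hsymm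
    _ = _ := lintegral_prod_symm' _ hsymm

/-- Elastic scattering in the center-of-mass frame is reversible. -/
theorem lintegral_scattering_swap {K : Momentum × Momentum → ℝ≥0∞} (hK : Measurable K) :
    ∫⁻ k : Momentum, ∫⁻ Ω : Direction, K (k, ‖k‖ • (Ω : Momentum))
        ∂(volume : Measure Momentum).toSphere =
      ∫⁻ k : Momentum, ∫⁻ Ω : Direction, K (‖k‖ • (Ω : Momentum), k)
        ∂(volume : Measure Momentum).toSphere := by
  have h1 : Measurable fun k : Momentum => ∫⁻ Ω : Direction, K (k, ‖k‖ • (Ω : Momentum))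
      ∂(volume : Measure Momentum).toSphere :=
    Measurable.lintegral_prod_right'
      (f := fun z : Momentum × Direction => K (z.1, ‖z.1‖ • (z.2 : Momentum))) (by fun_prop)
  have h2 : Measurable fun k : Momentum => ∫⁻ Ω : Direction, K (‖k‖ • (Ω : Momentum), k)
      ∂(volume : Measure Momentum).toSphere :=
    Measurable.lintegral_prod_right'
      (f := fun z : Momentum × Direction => K (‖z.1‖ • (z.2 : Momentum), z.1)) (by fun_prop)
  -- On a sphere of radius $r$ both momenta, $r\omega$ and $r\Omega$, range over the same measure,
  -- so Tonelli exchanges them.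
  rw [lintegral_polar h1, lintegral_polar h2]
  refine lintegral_congr fun r => ?_
  have hr : ∀ ω : Direction, ‖(r : ℝ) • (ω : Momentum)‖ = r := fun ω => by
    rw [norm_smul, norm_eq_of_mem_sphere, mul_one, Real.norm_of_nonneg (le_of_lt r.2)]
  simp only [hr]
  exact lintegral_lintegral_swap (by fun_prop)

/-- Replace $q$ by $P=p+q$ and then $p$ by $k$. The outgoing particle is the boost of $\|k\|\Omega$,
so exchanging incoming and outgoing momenta becomes exchanging $k$ and $\|k\|\Omega$ at fixed $P$.
-/
theorem lintegral_collision_eq (m : ℝ) {F : Momentum × Momentum × Momentum × Momentum → ℝ≥0∞}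
    (hF : Measurable F) :
    ∫⁻ p, ∫⁻ q, ∫⁻ Ω : Direction, ENNReal.ofReal (mollerVelocity m p q) *
        F (p, q, outgoing m p q Ω, outgoingPartner m p q Ω)
        ∂(volume : Measure Momentum).toSphere =
      ∫⁻ P, ∫⁻ k : Momentum, ∫⁻ Ω : Direction,
        ENNReal.ofReal (4 * ‖k‖ / pairEnergy m P k) *
        F (pairBoost m P k, P - pairBoost m P k, pairBoost m P (‖k‖ • (Ω : Momentum)),
          P - pairBoost m P (‖k‖ • (Ω : Momentum))) ∂(volume : Measure Momentum).toSphere := by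
  have hmol := measurable_mollerVelocity m
  have hout := measurable_outgoing m
  have hI : Measurable fun z : Momentum × Momentum => ∫⁻ Ω : Direction,
      F (z.1, z.2, outgoing m z.1 z.2 Ω, outgoingPartner m z.1 z.2 Ω)
        ∂(volume : Measure Momentum).toSphere := by
    refine Measurable.lintegral_prod_right'
      (f := fun w : (Momentum × Momentum) × Direction => F (w.1.1, w.1.2,
        outgoing m w.1.1 w.1.2 w.2, outgoingPartner m w.1.1 w.1.2 w.2)) ?_
    have h1 : Measurable fun w : (Momentum × Momentum) × Direction =>
        outgoing m w.1.1 w.1.2 w.2 :=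
      hout.comp (f := fun w : (Momentum × Momentum) × Direction => (w.1.1, w.1.2, (w.2 : Momentum)))
        (by fun_prop)
    unfold outgoingPartner
    fun_prop
  have hA : ∀ p q, ∫⁻ Ω : Direction, ENNReal.ofReal (mollerVelocity m p q) *
        F (p, q, outgoing m p q Ω, outgoingPartner m p q Ω)
        ∂(volume : Measure Momentum).toSphere = ENNReal.ofReal (mollerVelocity m p q) *
        ∫⁻ Ω : Direction, F (p, q, outgoing m p q Ω, outgoingPartner m p q Ω)
        ∂(volume : Measure Momentum).toSphere :=
    fun p q => lintegral_const_mul' _ _ ENNReal.ofReal_ne_top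
  simp only [hA]
  set Φ : Momentum × Momentum → ℝ≥0∞ := fun z => ∫⁻ Ω : Direction,
      F (z.1, z.2, outgoing m z.1 z.2 Ω, outgoingPartner m z.1 z.2 Ω)
        ∂(volume : Measure Momentum).toSphere with hΦ
  calc ∫⁻ p, ∫⁻ q, ENNReal.ofReal (mollerVelocity m p q) * Φ (p, q)
      = ∫⁻ p, ∫⁻ P, ENNReal.ofReal (mollerVelocity m p (P - p)) * Φ (p, P - p) := by
        refine lintegral_congr fun p => ?_
        exact (lintegral_sub_right_eq_self
          (fun q => ENNReal.ofReal (mollerVelocity m p q) * Φ (p, q)) p).symm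
    _ = ∫⁻ P, ∫⁻ p, ENNReal.ofReal (mollerVelocity m p (P - p)) * Φ (p, P - p) := by
        refine lintegral_lintegral_swap ?_
        have h1 : Measurable fun z : Momentum × Momentum => mollerVelocity m z.1 (z.2 - z.1) :=
          hmol.comp (f := fun z : Momentum × Momentum => (z.1, z.2 - z.1)) (by fun_prop)
        have h2 : Measurable fun z : Momentum × Momentum => Φ (z.1, z.2 - z.1) :=
          hI.comp (f := fun z : Momentum × Momentum => (z.1, z.2 - z.1)) (by fun_prop)
        exact (h1.ennreal_ofReal.mul h2).aemeasurable
    _ = ∫⁻ P, ∫⁻ k, ENNReal.ofReal (4 * ‖k‖ / pairEnergy m P k) *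
          Φ (pairBoost m P k, P - pairBoost m P k) :=
        lintegral_congr fun P => lintegral_mollerVelocity_mul m P (fun p => Φ (p, P - p))
    _ = _ := by
        refine lintegral_congr fun P => lintegral_congr fun k => ?_
        rw [lintegral_const_mul' _ _ ENNReal.ofReal_ne_top]
        -- At $k=0$ the boost formula for the outgoing momentum is unavailable, but the weight
        -- vanishes.
        rcases eq_or_ne k 0 with rfl | hk
        · simp
        · congr 1
          refine lintegral_congr fun Ω => ?_
          rw [outgoingPartner, outgoing_pairBoost m P hk (norm_eq_of_mem_sphere Ω), add_sub_cancel]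

/-- Microscopic reversibility: the collision measure `v_Møl d³p d³q dΩ` is invariant under the
exchange of the incoming and outgoing momenta. -/
theorem lintegral_collision_swap (m : ℝ)
    {F : Momentum × Momentum × Momentum × Momentum → ℝ≥0∞} (hF : Measurable F) :
    ∫⁻ p, ∫⁻ q, ∫⁻ Ω : Direction, ENNReal.ofReal (mollerVelocity m p q) *
        F (p, q, outgoing m p q Ω, outgoingPartner m p q Ω)
        ∂(volume : Measure Momentum).toSphere =
      ∫⁻ p, ∫⁻ q, ∫⁻ Ω : Direction, ENNReal.ofReal (mollerVelocity m p q) *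
        F (outgoing m p q Ω, outgoingPartner m p q Ω, p, q)
        ∂(volume : Measure Momentum).toSphere := by
  have hF' : Measurable fun x : Momentum × Momentum × Momentum × Momentum =>
      F (x.2.2.1, x.2.2.2, x.1, x.2.1) := by fun_prop
  refine (lintegral_collision_eq m hF).trans (Eq.trans ?_ (lintegral_collision_eq m hF').symm)
  refine lintegral_congr fun P => ?_
  have hb := measurable_pairBoost m P
  have hE' := measurable_pairEnergy m P
  let K : Momentum × Momentum → ℝ≥0∞ := fun z =>
    ENNReal.ofReal (4 * ‖z.1‖ / pairEnergy m P z.1) *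
      F (pairBoost m P z.1, P - pairBoost m P z.1, pairBoost m P z.2, P - pairBoost m P z.2)
  have hK : Measurable K := by
    have h1 : Measurable fun z : Momentum × Momentum => pairBoost m P z.1 := hb.comp measurable_fst
    have h2 : Measurable fun z : Momentum × Momentum => pairBoost m P z.2 := hb.comp measurable_snd
    have h3 : Measurable fun z : Momentum × Momentum => 4 * ‖z.1‖ / pairEnergy m P z.1 :=
      (measurable_fst.norm.const_mul 4).div (hE'.comp measurable_fst)
    exact h3.ennreal_ofReal.mul (hF.comp (h1.prodMk
      ((h1.const_sub P).prodMk (h2.prodMk (h2.const_sub P)))))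
  refine (lintegral_scattering_swap hK).trans
    (lintegral_congr fun k => lintegral_congr fun Ω => ?_)
  have hn : ‖‖k‖ • (Ω : Momentum)‖ = ‖k‖ := by
    rw [norm_smul, norm_norm, norm_eq_of_mem_sphere, mul_one]
  simp only [K, pairEnergy_eq_of_norm_eq m P hn, hn]

end CollisionSymmetry

/-! ### Conservation laws and the exchange of the particles -/

section Reversibility

theorem exists_eq_pairBoost_outgoing {m : ℝ} {p q ω : Momentum}
    (h : mollerVelocity m p q ≠ 0) (hω : ‖ω‖ = 1) :
    ∃ k l : Momentum, k ≠ 0 ∧ ‖l‖ = ‖k‖ ∧ p = pairBoost m (p + q) k ∧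
      q = p + q - pairBoost m (p + q) k ∧ outgoing m p q ω = pairBoost m (p + q) l ∧
      outgoingPartner m p q ω = p + q - pairBoost m (p + q) l := by
  obtain ⟨k, hk, hkp⟩ := exists_pairBoost_eq h
  have hq : q = p + q - pairBoost m (p + q) k := by rw [hkp, add_sub_cancel_left]
  have hout : outgoing m p q ω = pairBoost m (p + q) (‖k‖ • ω) := by
    have := outgoing_pairBoost m (p + q) hk hω
    rwa [← hq, hkp] at this
  exact ⟨k, ‖k‖ • ω, hk, by rw [norm_smul, norm_norm, hω, mul_one], hkp.symm, hq, hout, by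
    rw [outgoingPartner, hout]⟩

theorem energy_outgoing_add {m : ℝ} {p q ω : Momentum}
    (h : mollerVelocity m p q ≠ 0) (hω : ‖ω‖ = 1) :
    energy m (outgoing m p q ω) + energy m (outgoingPartner m p q ω) =
      energy m p + energy m q := by
  obtain ⟨k, l, hk, hl, hp, hq, hp', hq'⟩ := exists_eq_pairBoost_outgoing h hω
  have hl0 : l ≠ 0 := by rwa [← norm_ne_zero_iff, hl, norm_ne_zero_iff]
  have h1 := energy_pairBoost_add m (p + q) hk
  rw [← hp, add_sub_cancel_left] at h1
  rw [hp', hq', energy_pairBoost_add m _ hl0, h1, pairEnergy_eq_of_norm_eq m _ hl]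

theorem outgoing_add_outgoingPartner (m : ℝ) (p q ω : Momentum) :
    outgoing m p q ω + outgoingPartner m p q ω = p + q := by
  rw [outgoingPartner, add_sub_cancel]

theorem fourMomentum_outgoing_add {m : ℝ} {p q ω : Momentum}
    (h : mollerVelocity m p q ≠ 0) (hω : ‖ω‖ = 1) :
    fourMomentum m (outgoing m p q ω) + fourMomentum m (outgoingPartner m p q ω) =
      fourMomentum m p + fourMomentum m q := by
  funext μ
  refine Fin.cases ?_ (fun j => ?_) μ
  · simpa [fourMomentum] using energy_outgoing_add h hω
  · have := congrArg (fun x : Momentum => x j) (outgoing_add_outgoingPartner m p q ω)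
    simpa [fourMomentum] using this

theorem minkowski_comm (a b : Fin 4 → ℝ) : minkowski a b = minkowski b a := by
  simp [minkowski, mul_comm]

theorem minkowski_add_right (a b c : Fin 4 → ℝ) :
    minkowski a (b + c) = minkowski a b + minkowski a c := by
  simp [minkowski, mul_add, Finset.sum_add_distrib]
  ring

theorem minkowski_neg_neg (a b : Fin 4 → ℝ) : minkowski (-a) (-b) = minkowski a b := by
  simp [minkowski]

/-- Relabelling the particles reverses the center-of-mass scattering direction. -/
theorem outgoing_neg (m : ℝ) (p q ω : Momentum) :
    outgoing m q p (-ω) = outgoingPartner m p q ω := by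
  rw [outgoingPartner, outgoing, outgoing, mandelstamS_comm m q p, add_comm q p,
    add_comm (energy m q), inner_neg_right]
  module

theorem outgoingPartner_neg (m : ℝ) (p q ω : Momentum) :
    outgoingPartner m q p (-ω) = outgoing m p q ω := by
  rw [outgoingPartner, outgoing_neg, outgoingPartner, add_comm q p, sub_sub_cancel]

open scoped Pointwise in
-- The surface measure of a set is given by the volume of the cone over it, and volume is invariant
-- under $x\mapsto-x$.
theorem map_neg_toSphere :
    (volume : Measure Momentum).toSphere.map (fun ω : Direction => -ω) =
      (volume : Measure Momentum).toSphere := by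
  have hneg : Measurable fun ω : Direction => -ω := continuous_neg.measurable
  ext s hs
  rw [Measure.map_apply hneg hs, Measure.toSphere_apply' _ (hneg hs),
    Measure.toSphere_apply' _ hs]
  congr 1
  have h : Set.Ioo (0 : ℝ) 1 • ((↑) '' ((fun ω : Direction => -ω) ⁻¹' s) : Set Momentum) =
      -(Set.Ioo (0 : ℝ) 1 • ((↑) '' s : Set Momentum)) := by
    ext x
    simp only [Set.mem_smul, Set.mem_image, Set.mem_preimage, Set.mem_neg]
    constructor
    · rintro ⟨r, hr, _, ⟨ω, hω, rfl⟩, rfl⟩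
      exact ⟨r, hr, _, ⟨-ω, hω, rfl⟩, by simp⟩
    · rintro ⟨r, hr, _, ⟨ω, hω, rfl⟩, h⟩
      exact ⟨r, hr, _, ⟨-ω, by simpa using hω, rfl⟩, by simp [h]⟩
  rw [h, Measure.measure_neg]

theorem lintegral_toSphere_neg {F : Direction → ℝ≥0∞} (hF : Measurable F) :
    ∫⁻ ω, F (-ω) ∂(volume : Measure Momentum).toSphere =
      ∫⁻ ω, F ω ∂(volume : Measure Momentum).toSphere := by
  conv_rhs => rw [← map_neg_toSphere]
  rw [lintegral_map hF continuous_neg.measurable]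

end Reversibility

/-! ### The equilibrium collision measure and its symmetries -/

namespace Gas

variable (G : Gas)

/-- Detailed balance: the product depends only on the total four-momentum, which collisions
conserve. -/
theorem feq_mul_feq (p q : Momentum) : G.feq p * G.feq q =
    Real.exp (2 * G.α + minkowski (Fin.cons G.β₀ fun j => G.β j)
      (fourMomentum G.mass p + fourMomentum G.mass q)) := by
  rw [feq, feq, ← Real.exp_add, minkowski_add_right]
  congr 1
  ring

theorem feq_pos (p : Momentum) : 0 < G.feq p := Real.exp_pos _

theorem measurable_feq : Measurable G.feq := by
  unfold feq
  refine Real.measurable_exp.comp (Measurable.const_add ?_ _)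
  exact measurable_minkowski.comp
    (f := fun p => ((Fin.cons G.β₀ fun j => G.β j : Fin 4 → ℝ), fourMomentum G.mass p))
    (measurable_const.prodMk (measurable_fourMomentum _))

/-- The density `f_eq / (2π)³`. -/
noncomputable def density (p : Momentum) : ℝ≥0∞ := ENNReal.ofReal (G.feq p / (2 * Real.pi) ^ 3)

theorem measurable_density : Measurable G.density :=
  (G.measurable_feq.div_const _).ennreal_ofReal

theorem measure_eq : G.measure = volume.withDensity G.density := rfl

instance : SigmaFinite G.measure :=
  SigmaFinite.withDensity_ofReal fun p => G.feq p / (2 * Real.pi) ^ 3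

instance : SFinite G.partnerMeasure := by
  unfold partnerMeasure
  infer_instance

theorem density_mul_density (p q : Momentum) : G.density p * G.density q =
    ENNReal.ofReal (G.feq p * G.feq q / ((2 * Real.pi) ^ 3 * (2 * Real.pi) ^ 3)) := by
  rw [density, density, ← ENNReal.ofReal_mul (div_nonneg (G.feq_pos p).le (by positivity))]
  congr 1
  ring

theorem rate_nonneg (p : Momentum) (z : Momentum × Direction) : 0 ≤ G.rate p z := by
  unfold rate
  have := mollerVelocity_nonneg G.mass p z.1
  positivity

theorem mollerVelocity_ne_zero_of_rate_ne_zero {p : Momentum} {z : Momentum × Direction}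
    (h : G.rate p z ≠ 0) : mollerVelocity G.mass p z.1 ≠ 0 := by
  rintro h0
  exact h (by rw [rate, h0, zero_mul, zero_div])

/-- The four momenta of a collision, incoming and outgoing. -/
noncomputable def collide (x : Momentum × Momentum × Direction) :
    Momentum × Momentum × Momentum × Momentum :=
  (x.1, x.2.1, outgoing G.mass x.1 x.2.1 x.2.2, outgoingPartner G.mass x.1 x.2.1 x.2.2)

theorem measurable_collide : Measurable G.collide := by
  have h1 : Measurable fun x : Momentum × Momentum × Direction =>
      outgoing G.mass x.1 x.2.1 x.2.2 :=
    (measurable_outgoing G.mass).comp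
      (f := fun x : Momentum × Momentum × Direction => (x.1, x.2.1, (x.2.2 : Momentum)))
      (by fun_prop)
  unfold collide outgoingPartner
  fun_prop

/-- The cross section, as a function of the incoming and outgoing momenta. -/
noncomputable def crossSectionOf (y : Momentum × Momentum × Momentum × Momentum) : ℝ≥0∞ :=
  ENNReal.ofReal (G.crossSection (mandelstamS G.mass y.1 y.2.1)
    (minkowski (fourMomentum G.mass y.1 - fourMomentum G.mass y.2.1)
      (fourMomentum G.mass y.2.2.1 - fourMomentum G.mass y.2.2.2)
    / (mandelstamS G.mass y.1 y.2.1 - 4 * G.mass ^ 2)) / 2)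

theorem measurable_crossSectionOf : Measurable G.crossSectionOf := by
  have hs : Measurable fun y : Momentum × Momentum × Momentum × Momentum =>
      mandelstamS G.mass y.1 y.2.1 :=
    (measurable_mandelstamS G.mass).comp
      (f := fun y : Momentum × Momentum × Momentum × Momentum => (y.1, y.2.1)) (by fun_prop)
  have hf := measurable_fourMomentum G.mass
  have hm : Measurable fun y : Momentum × Momentum × Momentum × Momentum =>
      minkowski (fourMomentum G.mass y.1 - fourMomentum G.mass y.2.1)
        (fourMomentum G.mass y.2.2.1 - fourMomentum G.mass y.2.2.2) :=
    measurable_minkowski.comp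
      (f := fun y : Momentum × Momentum × Momentum × Momentum =>
        (fourMomentum G.mass y.1 - fourMomentum G.mass y.2.1,
          fourMomentum G.mass y.2.2.1 - fourMomentum G.mass y.2.2.2)) (by fun_prop)
  have hσ := G.measurable_crossSection.comp (hs.prodMk (hm.div (hs.sub_const (4 * G.mass ^ 2))))
  exact (hσ.coe_nnreal_real.div_const 2).ennreal_ofReal

theorem ofReal_rate (p q : Momentum) (ω : Direction) :
    ENNReal.ofReal (G.rate p (q, ω)) =
      ENNReal.ofReal (mollerVelocity G.mass p q) * G.crossSectionOf (G.collide (p, q, ω)) := by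
  rw [rate, crossSectionOf, ← ENNReal.ofReal_mul (mollerVelocity_nonneg _ _ _), ← mul_div_assoc]
  rfl

theorem measurable_ofReal_rate :
    Measurable fun x : Momentum × Momentum × Direction => ENNReal.ofReal (G.rate x.1 x.2) := by
  have h1 : Measurable fun x : Momentum × Momentum × Direction =>
      mollerVelocity G.mass x.1 x.2.1 :=
    (measurable_mollerVelocity G.mass).comp
      (f := fun x : Momentum × Momentum × Direction => (x.1, x.2.1)) (by fun_prop)
  have h2 : (fun x : Momentum × Momentum × Direction => ENNReal.ofReal (G.rate x.1 x.2)) =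
      fun x => ENNReal.ofReal (mollerVelocity G.mass x.1 x.2.1) * G.crossSectionOf (G.collide x) :=
    funext fun x => G.ofReal_rate x.1 x.2.1 x.2.2
  rw [h2]
  exact h1.ennreal_ofReal.mul (G.measurable_crossSectionOf.comp G.measurable_collide)

/-- The distribution of the incoming and outgoing momenta of the collisions in equilibrium. -/
noncomputable def collisionMeasure : Measure (Momentum × Momentum × Momentum × Momentum) :=
  ((G.measure.prod G.partnerMeasure).withDensity fun x => ENNReal.ofReal (G.rate x.1 x.2)).map
    G.collide

theorem lintegral_collisionMeasure
    {F : Momentum × Momentum × Momentum × Momentum → ℝ≥0∞} (hF : Measurable F) :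
    ∫⁻ y, F y ∂G.collisionMeasure =
      ∫⁻ p, ∫⁻ q, ∫⁻ Ω : Direction, ENNReal.ofReal (mollerVelocity G.mass p q) *
        (G.density p * G.density q * G.crossSectionOf (G.collide (p, q, Ω)) *
          F (G.collide (p, q, Ω))) ∂(volume : Measure Momentum).toSphere := by
  have hr := G.measurable_ofReal_rate
  have hFc : Measurable fun x => F (G.collide x) := hF.comp G.measurable_collide
  have hI : Measurable fun x : Momentum × Momentum × Direction =>
      ENNReal.ofReal (G.rate x.1 x.2) * F (G.collide x) := hr.mul hFc
  rw [collisionMeasure, lintegral_map hF G.measurable_collide,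
    lintegral_withDensity_eq_lintegral_mul _ hr hFc]
  simp only [Pi.mul_apply]
  rw [lintegral_prod _ hI.aemeasurable, measure_eq,
    lintegral_withDensity_eq_lintegral_mul _ G.measurable_density hI.lintegral_prod_right']
  refine lintegral_congr fun p => ?_
  have hIp : Measurable fun z : Momentum × Direction =>
      ENNReal.ofReal (G.rate p z) * F (G.collide (p, z)) :=
    hI.comp (f := fun z => (p, z)) measurable_prodMk_left
  rw [Pi.mul_apply, partnerMeasure, lintegral_prod _ hIp.aemeasurable, measure_eq,
    lintegral_withDensity_eq_lintegral_mul _ G.measurable_density hIp.lintegral_prod_right',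
    ← lintegral_const_mul _ (G.measurable_density.mul hIp.lintegral_prod_right')]
  refine lintegral_congr fun q => ?_
  have hIq : Measurable fun Ω : Direction =>
      ENNReal.ofReal (G.rate p (q, Ω)) * F (G.collide (p, q, Ω)) :=
    hIp.comp (f := fun Ω => (q, Ω)) measurable_prodMk_left
  rw [Pi.mul_apply, ← mul_assoc, ← lintegral_const_mul _ hIq]
  refine lintegral_congr fun Ω => ?_
  rw [ofReal_rate]
  ring

/-- Exchange of incoming and outgoing momenta. -/
def swapInOut (y : Momentum × Momentum × Momentum × Momentum) :
    Momentum × Momentum × Momentum × Momentum := (y.2.2.1, y.2.2.2, y.1, y.2.1)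

/-- Exchange of the two particles. -/
def swapParticles (y : Momentum × Momentum × Momentum × Momentum) :
    Momentum × Momentum × Momentum × Momentum := (y.2.1, y.1, y.2.2.2, y.2.2.1)

theorem measurable_swapInOut : Measurable swapInOut := by unfold swapInOut; fun_prop

theorem measurable_swapParticles : Measurable swapParticles := by unfold swapParticles; fun_prop

/-- Reversibility of the kinematic measure, together with the invariance of the density product, of
$s$ and of the scattering angle. -/
theorem lintegral_collisionMeasure_swapInOut
    {F : Momentum × Momentum × Momentum × Momentum → ℝ≥0∞} (hF : Measurable F) :
    ∫⁻ y, F (swapInOut y) ∂G.collisionMeasure = ∫⁻ y, F y ∂G.collisionMeasure := by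
  have hd := G.measurable_density
  have hσ := G.measurable_crossSectionOf
  have hF' : Measurable fun y => F (swapInOut y) := hF.comp measurable_swapInOut
  rw [G.lintegral_collisionMeasure hF', G.lintegral_collisionMeasure hF]
  refine Eq.trans ?_ (lintegral_collision_swap G.mass
    (F := fun y => G.density y.1 * G.density y.2.1 * G.crossSectionOf y * F y)
    (by fun_prop)).symm
  refine lintegral_congr fun p => lintegral_congr fun q => lintegral_congr fun Ω => ?_
  -- Energy conservation is only known where the Møller velocity is nonzero; elsewhere both sides
  -- vanish.
  by_cases h : mollerVelocity G.mass p q = 0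
  · rw [h, ENNReal.ofReal_zero, zero_mul, zero_mul]
  have hω := norm_eq_of_mem_sphere Ω
  have h4 := fourMomentum_outgoing_add h hω
  have hs : mandelstamS G.mass (outgoing G.mass p q Ω) (outgoingPartner G.mass p q Ω) =
      mandelstamS G.mass p q := by rw [mandelstamS, mandelstamS, h4]
  simp only [density_mul_density, feq_mul_feq, crossSectionOf, collide, swapInOut, h4, hs]
  rw [minkowski_comm (fourMomentum G.mass p - fourMomentum G.mass q)]

theorem lintegral_collisionMeasure_swapParticles
    {F : Momentum × Momentum × Momentum × Momentum → ℝ≥0∞} (hF : Measurable F) :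
    ∫⁻ y, F (swapParticles y) ∂G.collisionMeasure = ∫⁻ y, F y ∂G.collisionMeasure := by
  have hd := G.measurable_density
  have hσ := G.measurable_crossSectionOf
  have hmol := measurable_mollerVelocity G.mass
  have hcol := G.measurable_collide
  have hF' : Measurable fun y => F (swapParticles y) := hF.comp measurable_swapParticles
  rw [G.lintegral_collisionMeasure hF', G.lintegral_collisionMeasure hF]
  set A : Momentum × Momentum × Direction → ℝ≥0∞ := fun x =>
    ENNReal.ofReal (mollerVelocity G.mass x.1 x.2.1) *
      (G.density x.1 * G.density x.2.1 * G.crossSectionOf (G.collide x) * F (G.collide x)) with hA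
  have hmol' : Measurable fun x : Momentum × Momentum × Direction =>
      mollerVelocity G.mass x.1 x.2.1 :=
    hmol.comp (f := fun x : Momentum × Momentum × Direction => (x.1, x.2.1)) (by fun_prop)
  have hAm : Measurable A := by fun_prop
  have hswap : ∀ p q (Ω : Direction), ENNReal.ofReal (mollerVelocity G.mass p q) *
        (G.density p * G.density q * G.crossSectionOf (G.collide (p, q, Ω)) *
          F (swapParticles (G.collide (p, q, Ω)))) = A (q, p, -Ω) := by
    intro p q Ω
    have h1 : G.collide (q, p, -Ω) = swapParticles (G.collide (p, q, Ω)) := by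
      simp [collide, swapParticles, outgoing_neg, outgoingPartner_neg]
    have h2 : G.crossSectionOf (swapParticles (G.collide (p, q, Ω))) =
        G.crossSectionOf (G.collide (p, q, Ω)) := by
      simp only [crossSectionOf, swapParticles]
      rw [mandelstamS_comm, ← minkowski_neg_neg, neg_sub, neg_sub]
    simp only [hA, h1, h2]
    rw [mollerVelocity_comm, mul_comm (G.density p)]
  have hAq : ∀ p q, Measurable fun Ω : Direction => A (q, p, Ω) := fun p q =>
    hAm.comp (measurable_prodMk_left.comp measurable_prodMk_left)
  have hneg : ∀ p q, ∫⁻ Ω : Direction, A (q, p, -Ω) ∂(volume : Measure Momentum).toSphere =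
      ∫⁻ Ω : Direction, A (q, p, Ω) ∂(volume : Measure Momentum).toSphere := fun p q =>
    lintegral_toSphere_neg (hAq p q)
  simp only [hswap, hneg]
  refine lintegral_lintegral_swap (f := fun p q => ∫⁻ Ω : Direction, A (q, p, Ω)
    ∂(volume : Measure Momentum).toSphere) ?_
  refine (Measurable.lintegral_prod_right'
    (f := fun w : (Momentum × Momentum) × Direction => A (w.1.2, w.1.1, w.2)) ?_).aemeasurable
  exact hAm.comp (f := fun w : (Momentum × Momentum) × Direction => (w.1.2, w.1.1, w.2))
    (by fun_prop)

theorem measurePreserving_swapInOut :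
    MeasurePreserving swapInOut G.collisionMeasure G.collisionMeasure := by
  refine ⟨measurable_swapInOut, Measure.ext_of_lintegral _ fun F hF => ?_⟩
  rw [lintegral_map hF measurable_swapInOut, G.lintegral_collisionMeasure_swapInOut hF]

theorem measurePreserving_swapParticles :
    MeasurePreserving swapParticles G.collisionMeasure G.collisionMeasure := by
  refine ⟨measurable_swapParticles, Measure.ext_of_lintegral _ fun F hF => ?_⟩
  rw [lintegral_map hF measurable_swapParticles, G.lintegral_collisionMeasure_swapParticles hF]

theorem ae_of_ae_collisionMeasure {Q : Momentum × Momentum × Momentum × Momentum → Prop}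
    (hQ : ∀ᵐ y ∂G.collisionMeasure, Q y) :
    ∀ᵐ p ∂G.measure, ∀ᵐ z ∂G.partnerMeasure, G.rate p z ≠ 0 → Q (G.collide (p, z)) := by
  have h1 := ae_of_ae_map G.measurable_collide.aemeasurable hQ
  rw [ae_withDensity_iff G.measurable_ofReal_rate] at h1
  have h2 := Measure.ae_ae_of_ae_prod h1
  filter_upwards [h2] with p hp
  filter_upwards [hp] with z hz hne
  exact hz (ENNReal.ofReal_pos.2 ((G.rate_nonneg p z).lt_of_ne' hne)).ne'

/-- Combined with the two exchanges, this makes all four momenta of a collision avoid null sets, so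
the balance of an $L^2$ class is well defined almost everywhere. -/
theorem quasiMeasurePreserving_fst :
    Measure.QuasiMeasurePreserving (fun y : Momentum × Momentum × Momentum × Momentum => y.1)
      G.collisionMeasure G.measure := by
  refine ⟨measurable_fst, ?_⟩
  rw [collisionMeasure, Measure.map_map measurable_fst G.measurable_collide]
  have h1 : ((G.measure.prod G.partnerMeasure).withDensity
      fun x => ENNReal.ofReal (G.rate x.1 x.2)) ≪ G.measure.prod G.partnerMeasure :=
    withDensity_absolutelyContinuous _ _
  have h2 : (Prod.fst ∘ G.collide : Momentum × Momentum × Direction → Momentum) = Prod.fst := rfl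
  exact (h1.map (f := Prod.fst) measurable_fst).trans
    (Measure.quasiMeasurePreserving_fst).absolutelyContinuous

/-- The collisional balance, as a function of the incoming and outgoing momenta. -/
def balanceOf (ψ : Momentum → ℂ) (y : Momentum × Momentum × Momentum × Momentum) : ℂ :=
  ψ y.1 + ψ y.2.1 - ψ y.2.2.1 - ψ y.2.2.2

theorem balanceOf_collide (ψ : Momentum → ℂ) (p : Momentum) (z : Momentum × Direction) :
    balanceOf ψ (G.collide (p, z)) = G.balance ψ p z := rfl

theorem balanceOf_swapInOut (ψ : Momentum → ℂ) (y : Momentum × Momentum × Momentum × Momentum) :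
    balanceOf ψ (swapInOut y) = -balanceOf ψ y := by
  simp only [balanceOf, swapInOut]; ring

theorem balanceOf_swapParticles (ψ : Momentum → ℂ)
    (y : Momentum × Momentum × Momentum × Momentum) :
    balanceOf ψ (swapParticles y) = balanceOf ψ y := by
  simp only [balanceOf, swapParticles]; ring

theorem balanceOf_congr_ae {ψ φ : Momentum → ℂ} (h : ψ =ᵐ[G.measure] φ) :
    balanceOf ψ =ᵐ[G.collisionMeasure] balanceOf φ := by
  have h1 := G.quasiMeasurePreserving_fst.ae_eq_comp h
  have h2 := G.measurePreserving_swapParticles.quasiMeasurePreserving.ae_eq_comp h1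
  have h3 := G.measurePreserving_swapInOut.quasiMeasurePreserving.ae_eq_comp h1
  have h4 := G.measurePreserving_swapInOut.quasiMeasurePreserving.ae_eq_comp h2
  filter_upwards [h1, h2, h3, h4] with y e1 e2 e3 e4
  simp only [Function.comp_apply, swapInOut, swapParticles] at e1 e2 e3 e4
  rw [balanceOf, balanceOf, e1, e2, e3, e4]

theorem rate_mul_balance_congr_ae {ψ φ : Momentum → ℂ}
    (h : balanceOf ψ =ᵐ[G.collisionMeasure] balanceOf φ) :
    ∀ᵐ p ∂G.measure, ∀ᵐ z ∂G.partnerMeasure,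
      (G.rate p z : ℂ) * G.balance ψ p z = (G.rate p z : ℂ) * G.balance φ p z := by
  filter_upwards [G.ae_of_ae_collisionMeasure h] with p hp
  filter_upwards [hp] with z hz
  by_cases h0 : G.rate p z = 0
  · rw [h0, Complex.ofReal_zero, zero_mul, zero_mul]
  · rw [← balanceOf_collide, ← balanceOf_collide, hz h0]

theorem ae_conserved : ∀ᵐ y ∂G.collisionMeasure,
    fourMomentum G.mass y.2.2.1 + fourMomentum G.mass y.2.2.2 =
      fourMomentum G.mass y.1 + fourMomentum G.mass y.2.1 := by
  have hf := measurable_fourMomentum G.mass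
  rw [collisionMeasure, ae_map_iff G.measurable_collide.aemeasurable
    (measurableSet_eq_fun (by fun_prop) (by fun_prop)),
    ae_withDensity_iff G.measurable_ofReal_rate]
  refine Eventually.of_forall fun x hx => ?_
  have h0 : G.rate x.1 x.2 ≠ 0 := fun h => hx (by rw [h, ENNReal.ofReal_zero])
  exact fourMomentum_outgoing_add (G.mollerVelocity_ne_zero_of_rate_ne_zero h0)
    (norm_eq_of_mem_sphere _)

end Gas

/-! ### Symmetry, positivity and linearity of the linearized collision operator -/

theorem ennreal_mul_le_sq_add_sq (x y : ℝ≥0∞) : x * y ≤ x ^ 2 + y ^ 2 := by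
  rcases le_total x y with h | h
  · calc x * y ≤ y * y := by gcongr
      _ = y ^ 2 := (sq y).symm
      _ ≤ _ := le_add_self
  · calc x * y ≤ x * x := by gcongr
      _ = x ^ 2 := (sq x).symm
      _ ≤ _ := le_self_add

theorem ennreal_add_sq_le (x y : ℝ≥0∞) : (x + y) ^ 2 ≤ 3 * (x ^ 2 + y ^ 2) := by
  calc (x + y) ^ 2 = x ^ 2 + y ^ 2 + 2 * (x * y) := by ring
    _ ≤ x ^ 2 + y ^ 2 + 2 * (x ^ 2 + y ^ 2) := by gcongr; exact ennreal_mul_le_sq_add_sq x y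
    _ = _ := by ring

namespace Gas

variable (G : Gas)

theorem measurable_rate :
    Measurable fun x : Momentum × Momentum × Direction => G.rate x.1 x.2 := by
  have h : (fun x : Momentum × Momentum × Direction => G.rate x.1 x.2) =
      fun x => (ENNReal.ofReal (G.rate x.1 x.2)).toReal :=
    funext fun x => (ENNReal.toReal_ofReal (G.rate_nonneg _ _)).symm
  rw [h]
  exact G.measurable_ofReal_rate.ennreal_toReal

theorem stronglyMeasurable_balanceOf {ψ : Momentum → ℂ} (hψ : StronglyMeasurable ψ) :
    StronglyMeasurable (balanceOf ψ) := by
  have := hψ.measurable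
  unfold balanceOf
  exact Measurable.stronglyMeasurable (by fun_prop)

theorem stronglyMeasurable_rate_mul {f : Momentum × Momentum × Momentum × Momentum → ℂ}
    (hf : StronglyMeasurable f) :
    StronglyMeasurable fun x : Momentum × Momentum × Direction =>
      (G.rate x.1 x.2 : ℂ) * f (G.collide x) :=
  (Complex.measurable_ofReal.comp G.measurable_rate).stronglyMeasurable.mul
    (hf.comp_measurable G.measurable_collide)

theorem integrable_collisionMeasure_iff {f : Momentum × Momentum × Momentum × Momentum → ℂ}
    (hf : StronglyMeasurable f) : Integrable f G.collisionMeasure ↔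
      Integrable (fun x => (G.rate x.1 x.2 : ℂ) * f (G.collide x))
        (G.measure.prod G.partnerMeasure) := by
  rw [collisionMeasure, integrable_map_measure hf.aestronglyMeasurable
    G.measurable_collide.aemeasurable, integrable_withDensity_iff_integrable_smul'
    G.measurable_ofReal_rate (Eventually.of_forall fun _ => ENNReal.ofReal_lt_top)]
  refine iff_of_eq (congrArg (fun g => Integrable g _) (funext fun x => ?_))
  rw [ENNReal.toReal_ofReal (G.rate_nonneg _ _), Complex.real_smul]
  rfl

theorem integral_collisionMeasure {f : Momentum × Momentum × Momentum × Momentum → ℂ}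
    (hf : StronglyMeasurable f) (hint : Integrable f G.collisionMeasure) :
    ∫ y, f y ∂G.collisionMeasure =
      ∫ p, ∫ z, (G.rate p z : ℂ) * f (G.collide (p, z)) ∂G.partnerMeasure ∂G.measure := by
  have h := (G.integrable_collisionMeasure_iff hf).1 hint
  rw [← integral_prod _ h, collisionMeasure,
    integral_map G.measurable_collide.aemeasurable hf.aestronglyMeasurable,
    integral_withDensity_eq_integral_toReal_smul G.measurable_ofReal_rate
      (Eventually.of_forall fun _ => ENNReal.ofReal_lt_top)]
  refine integral_congr_ae (Eventually.of_forall fun x => ?_)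
  simp only
  rw [ENNReal.toReal_ofReal (G.rate_nonneg _ _), Complex.real_smul]

theorem lintegral_enorm_sq_lt_top (χ : G.State) : ∫⁻ p, ‖χ p‖ₑ ^ 2 ∂G.measure < ∞ := by
  have h := lintegral_rpow_enorm_lt_top_of_eLpNorm_lt_top (p := 2) two_ne_zero
    ENNReal.ofNat_ne_top (Lp.eLpNorm_lt_top χ)
  simpa using h

theorem measurable_absCollisionIntegral {ψ : Momentum → ℂ} (hψ : StronglyMeasurable ψ) :
    Measurable (G.absCollisionIntegral ψ) :=
  Measurable.lintegral_prod_right'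
    (f := fun x : Momentum × Momentum × Direction => ‖(G.rate x.1 x.2 : ℂ) * G.balance ψ x.1 x.2‖ₑ)
    (G.stronglyMeasurable_rate_mul (stronglyMeasurable_balanceOf hψ)).enorm

/-- The domain condition places the absolute collision integral in $L^2$, so its product with
$|\chi|$ is integrable. This licenses Fubini and the later symmetrization. -/
theorem integrable_conj_mul_balanceOf (χ : G.State) {ψ : G.State} (hψ : ψ ∈ G.collisionDomain) :
    Integrable (fun y => starRingEnd ℂ (χ y.1) * balanceOf ψ y) G.collisionMeasure := by
  have hχm := Lp.stronglyMeasurable χ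
  have hψm := Lp.stronglyMeasurable ψ
  have hf : StronglyMeasurable fun y : Momentum × Momentum × Momentum × Momentum =>
      starRingEnd ℂ (χ y.1) * balanceOf ψ y :=
    (Complex.continuous_conj.comp_stronglyMeasurable
      (hχm.comp_measurable measurable_fst)).mul (stronglyMeasurable_balanceOf hψm)
  rw [G.integrable_collisionMeasure_iff hf]
  have hm := G.stronglyMeasurable_rate_mul hf
  refine ⟨hm.aestronglyMeasurable, ?_⟩
  rw [HasFiniteIntegral, lintegral_prod _ hm.enorm.aemeasurable]
  have hI := G.measurable_absCollisionIntegral hψm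
  calc ∫⁻ p, ∫⁻ z, ‖(G.rate p z : ℂ) * (starRingEnd ℂ (χ p) * balanceOf ψ (G.collide (p, z)))‖ₑ
        ∂G.partnerMeasure ∂G.measure
      = ∫⁻ p, ‖χ p‖ₑ * G.absCollisionIntegral ψ p ∂G.measure := by
        refine lintegral_congr fun p => ?_
        rw [absCollisionIntegral, ← lintegral_const_mul' _ _ enorm_ne_top]
        refine lintegral_congr fun z => ?_
        rw [balanceOf_collide, mul_left_comm, enorm_mul]
        congr 1
        simp [← ofReal_norm]
    _ ≤ ∫⁻ p, (‖χ p‖ₑ ^ 2 + G.absCollisionIntegral ψ p ^ 2) ∂G.measure :=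
        lintegral_mono fun p => ennreal_mul_le_sq_add_sq _ _
    _ = ∫⁻ p, ‖χ p‖ₑ ^ 2 ∂G.measure + ∫⁻ p, G.absCollisionIntegral ψ p ^ 2 ∂G.measure :=
        lintegral_add_right _ (hI.pow_const 2)
    _ < ∞ := ENNReal.add_lt_top.2 ⟨G.lintegral_enorm_sq_lt_top χ, hψ⟩

theorem inner_eq_integral_conj_mul_balanceOf (χ : G.State) {x : G.State × G.State}
    (hx : x ∈ G.collisionGraph) :
    inner ℂ χ x.2 = ∫ y, starRingEnd ℂ (χ y.1) * balanceOf x.1 y ∂G.collisionMeasure := by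
  have hf : StronglyMeasurable fun y : Momentum × Momentum × Momentum × Momentum =>
      starRingEnd ℂ (χ y.1) * balanceOf x.1 y :=
    (Complex.continuous_conj.comp_stronglyMeasurable
      ((Lp.stronglyMeasurable χ).comp_measurable measurable_fst)).mul
      (stronglyMeasurable_balanceOf (Lp.stronglyMeasurable x.1))
  rw [G.integral_collisionMeasure hf (G.integrable_conj_mul_balanceOf χ hx.1), L2.inner_def]
  refine integral_congr_ae ?_
  filter_upwards [hx.2] with p hp
  rw [hp, RCLike.inner_apply, collisionIntegral, mul_comm, ← integral_const_mul]
  refine integral_congr_ae (Eventually.of_forall fun z => ?_)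
  simp only [collide]
  exact mul_left_comm _ _ _

/-- The quadratic form of the collision operator:
`(χ, I ψ) = ¼ ∫ conj(χ + χ - χ' - χ') (ψ + ψ - ψ' - ψ')`. -/
theorem four_mul_inner_eq (χ : G.State) {x : G.State × G.State} (hx : x ∈ G.collisionGraph) :
    4 * inner ℂ χ x.2 =
      ∫ y, starRingEnd ℂ (balanceOf χ y) * balanceOf x.1 y ∂G.collisionMeasure := by
  set f : Momentum × Momentum × Momentum × Momentum → ℂ :=
    fun y => starRingEnd ℂ (χ y.1) * balanceOf x.1 y with hf
  have hint : Integrable f G.collisionMeasure := G.integrable_conj_mul_balanceOf χ hx.1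
  have hcomp : ∀ {S : Momentum × Momentum × Momentum × Momentum →
      Momentum × Momentum × Momentum × Momentum}
      (_ : MeasurePreserving S G.collisionMeasure G.collisionMeasure),
      Integrable (fun y => f (S y)) G.collisionMeasure ∧
        ∫ y, f (S y) ∂G.collisionMeasure = ∫ y, f y ∂G.collisionMeasure := by
    intro S hS
    refine ⟨hS.integrable_comp_of_integrable hint, ?_⟩
    have h := integral_map (f := f) hS.measurable.aemeasurable
      (by rw [hS.map_eq]; exact hint.aestronglyMeasurable)
    rw [hS.map_eq] at h
    exact h.symm
  have hT := hcomp G.measurePreserving_swapParticles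
  have hS := hcomp G.measurePreserving_swapInOut
  have hTS := hcomp (G.measurePreserving_swapParticles.comp G.measurePreserving_swapInOut)
  -- Sum over the four-element group generated by the two exchanges: the balance of `x.1` is
  -- invariant or changes sign, and the four values of $\chi$ collect into its own balance with the
  -- same signs.
  have hsum : (fun y => starRingEnd ℂ (balanceOf χ y) * balanceOf x.1 y) = fun y =>
      f y + f (swapParticles y) + f (swapInOut y) + f ((swapParticles ∘ swapInOut) y) := by
    funext y
    simp only [hf, Function.comp_apply, balanceOf_swapParticles, balanceOf_swapInOut]
    simp only [balanceOf, swapParticles, swapInOut, map_sub, map_add]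
    ring
  have h2 : Integrable (fun y => f y + f (swapParticles y)) G.collisionMeasure := hint.add hT.1
  have h3 : Integrable (fun y => f y + f (swapParticles y) + f (swapInOut y))
      G.collisionMeasure := h2.add hS.1
  rw [hsum, integral_add h3 hTS.1, integral_add h2 hS.1, integral_add hint hT.1, hT.2, hS.2,
    hTS.2, G.inner_eq_integral_conj_mul_balanceOf χ hx]
  ring

theorem collisionGraph_symmetric : ∀ x ∈ G.collisionGraph, ∀ y ∈ G.collisionGraph,
    inner ℂ y.2 x.1 = inner ℂ y.1 x.2 := by
  intro x hx y hy
  have h1 := G.four_mul_inner_eq y.1 hx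
  have h2 := congrArg (starRingEnd ℂ) (G.four_mul_inner_eq x.1 hy)
  rw [map_mul, inner_conj_symm, ← integral_conj] at h2
  have h3 : (4 : ℂ) * inner ℂ y.2 x.1 = 4 * inner ℂ y.1 x.2 := by
    rw [h1, ← map_ofNat (starRingEnd ℂ) 4, h2]
    refine integral_congr_ae (Eventually.of_forall fun z => ?_)
    simp [mul_comm]
  exact mul_left_cancel₀ (by norm_num) h3

theorem collisionGraph_nonneg : ∀ x ∈ G.collisionGraph, 0 ≤ (inner ℂ x.1 x.2).re := by
  intro x hx
  have h1 := G.four_mul_inner_eq x.1 hx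
  have h2 : ∫ y, starRingEnd ℂ (balanceOf x.1 y) * balanceOf x.1 y ∂G.collisionMeasure =
      ((∫ y, ‖balanceOf x.1 y‖ ^ 2 ∂G.collisionMeasure : ℝ) : ℂ) := by
    rw [← integral_complex_ofReal]
    refine integral_congr_ae (Eventually.of_forall fun y => ?_)
    simp only
    rw [Complex.conj_mul', Complex.ofReal_pow]
  rw [h2] at h1
  have h3 := congrArg Complex.re h1
  rw [Complex.ofReal_re, show (4 : ℂ) = ((4 : ℝ) : ℂ) by norm_num, Complex.re_ofReal_mul] at h3
  have h4 : 0 ≤ ∫ y, ‖balanceOf x.1 y‖ ^ 2 ∂G.collisionMeasure :=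
    integral_nonneg fun y => by positivity
  linarith

theorem lintegral_absCollisionIntegral_sq_congr {ψ φ : Momentum → ℂ}
    (h : balanceOf ψ =ᵐ[G.collisionMeasure] balanceOf φ) :
    ∫⁻ p, G.absCollisionIntegral ψ p ^ 2 ∂G.measure =
      ∫⁻ p, G.absCollisionIntegral φ p ^ 2 ∂G.measure := by
  refine lintegral_congr_ae ?_
  filter_upwards [G.rate_mul_balance_congr_ae h] with p hp
  exact congrArg (· ^ 2) (lintegral_congr_ae (hp.mono fun z hz => by simp only [hz]))

theorem collisionIntegral_congr_ae {ψ φ : Momentum → ℂ}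
    (h : balanceOf ψ =ᵐ[G.collisionMeasure] balanceOf φ) :
    G.collisionIntegral ψ =ᵐ[G.measure] G.collisionIntegral φ := by
  filter_upwards [G.rate_mul_balance_congr_ae h] with p hp
  exact integral_congr_ae hp

theorem integrable_of_absCollisionIntegral_lt_top {ψ : Momentum → ℂ} (hψ : StronglyMeasurable ψ)
    {p : Momentum} (hp : G.absCollisionIntegral ψ p < ∞) :
    Integrable (fun z => (G.rate p z : ℂ) * G.balance ψ p z) G.partnerMeasure := by
  refine ⟨StronglyMeasurable.aestronglyMeasurable ?_, hp⟩
  exact (G.stronglyMeasurable_rate_mul (stronglyMeasurable_balanceOf hψ)).comp_measurable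
    (g := fun z => (p, z)) measurable_prodMk_left

theorem ae_absCollisionIntegral_lt_top {ψ : G.State} (hψ : ψ ∈ G.collisionDomain) :
    ∀ᵐ p ∂G.measure, G.absCollisionIntegral ψ p < ∞ := by
  have hm := (G.measurable_absCollisionIntegral (Lp.stronglyMeasurable ψ)).pow_const 2
  filter_upwards [ae_lt_top hm (ne_of_lt hψ)] with p hp
  exact (ENNReal.pow_lt_top_iff (n := 2)).1 hp |>.resolve_right two_ne_zero

/-- Only the balance enters the collision integral, so such a state may be replaced by the zero
function throughout. This is how the collision invariants enter the kernel. -/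
theorem mem_collisionGraph_of_balanceOf_eq_zero {e : G.State}
    (h : balanceOf e =ᵐ[G.collisionMeasure] 0) : (e, 0) ∈ G.collisionGraph := by
  have h0 : balanceOf e =ᵐ[G.collisionMeasure] balanceOf (fun _ => 0) := by
    filter_upwards [h] with y hy
    rw [hy]
    simp [balanceOf]
  constructor
  · have h2 : ∫⁻ p, G.absCollisionIntegral e p ^ 2 ∂G.measure = 0 := by
      rw [G.lintegral_absCollisionIntegral_sq_congr h0]
      simp [absCollisionIntegral, balance]
    change ∫⁻ p, G.absCollisionIntegral e p ^ 2 ∂G.measure < ∞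
    simp [h2]
  · refine (Lp.coeFn_zero ℂ 2 G.measure).trans ?_
    refine EventuallyEq.trans ?_ (G.collisionIntegral_congr_ae h0).symm
    exact Eventually.of_forall fun p => by simp [collisionIntegral, balance]

/-- The graph of the linearized collision operator, as a linear subspace. -/
noncomputable def collisionSubmodule : Submodule ℂ (G.State × G.State) where
  carrier := G.collisionGraph
  zero_mem' := by
    refine G.mem_collisionGraph_of_balanceOf_eq_zero ?_
    have h := G.balanceOf_congr_ae (Lp.coeFn_zero ℂ 2 G.measure)
    filter_upwards [h] with y hy
    rw [hy]
    simp [balanceOf]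
  add_mem' := by
    intro x y hx hy
    have hB : balanceOf (x.1 + y.1 : G.State) =ᵐ[G.collisionMeasure]
        balanceOf (fun p => x.1 p + y.1 p) := G.balanceOf_congr_ae (Lp.coeFn_add x.1 y.1)
    have hbal : ∀ p z, (G.rate p z : ℂ) * G.balance (fun p => x.1 p + y.1 p) p z =
        (G.rate p z : ℂ) * G.balance x.1 p z + (G.rate p z : ℂ) * G.balance y.1 p z := by
      intro p z
      simp only [balance]
      ring
    have hxm := Lp.stronglyMeasurable x.1
    have hym := Lp.stronglyMeasurable y.1
    constructor
    · change ∫⁻ p, G.absCollisionIntegral (x.1 + y.1 : G.State) p ^ 2 ∂G.measure < ∞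
      rw [G.lintegral_absCollisionIntegral_sq_congr hB]
      have hle : ∀ p, G.absCollisionIntegral (fun p => x.1 p + y.1 p) p ≤
          G.absCollisionIntegral x.1 p + G.absCollisionIntegral y.1 p := by
        intro p
        simp only [absCollisionIntegral, hbal]
        rw [← lintegral_add_left]
        · exact lintegral_mono fun z => enorm_add_le _ _
        · exact ((G.stronglyMeasurable_rate_mul (stronglyMeasurable_balanceOf hxm)).comp_measurable
            (g := fun z => (p, z)) measurable_prodMk_left).enorm
      calc ∫⁻ p, G.absCollisionIntegral (fun p => x.1 p + y.1 p) p ^ 2 ∂G.measure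
          ≤ ∫⁻ p, 3 * (G.absCollisionIntegral x.1 p ^ 2 + G.absCollisionIntegral y.1 p ^ 2)
            ∂G.measure :=
            lintegral_mono fun p => (pow_le_pow_left' (hle p) 2).trans (ennreal_add_sq_le _ _)
        _ = 3 * (∫⁻ p, G.absCollisionIntegral x.1 p ^ 2 ∂G.measure +
              ∫⁻ p, G.absCollisionIntegral y.1 p ^ 2 ∂G.measure) := by
            rw [lintegral_const_mul' _ _ ENNReal.ofNat_ne_top,
              lintegral_add_left ((G.measurable_absCollisionIntegral hxm).pow_const 2)]
        _ < ∞ := ENNReal.mul_lt_top ENNReal.ofNat_lt_top (ENNReal.add_lt_top.2 ⟨hx.1, hy.1⟩)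
    · refine (Lp.coeFn_add x.2 y.2).trans ?_
      filter_upwards [hx.2, hy.2, G.collisionIntegral_congr_ae hB,
        G.ae_absCollisionIntegral_lt_top hx.1, G.ae_absCollisionIntegral_lt_top hy.1]
        with p h1 h2 h3 h4 h5
      rw [Prod.fst_add, h3, Pi.add_apply, h1, h2]
      simp only [collisionIntegral, hbal]
      rw [integral_add (G.integrable_of_absCollisionIntegral_lt_top hxm h4)
        (G.integrable_of_absCollisionIntegral_lt_top hym h5)]
  smul_mem' := by
    intro c x hx
    have hB : balanceOf (c • x.1 : G.State) =ᵐ[G.collisionMeasure]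
        balanceOf (fun p => c * x.1 p) := G.balanceOf_congr_ae (Lp.coeFn_smul c x.1)
    have hbal : ∀ p z, (G.rate p z : ℂ) * G.balance (fun p => c * x.1 p) p z =
        c * ((G.rate p z : ℂ) * G.balance x.1 p z) := by
      intro p z
      simp only [balance]
      ring
    constructor
    · change ∫⁻ p, G.absCollisionIntegral (c • x.1 : G.State) p ^ 2 ∂G.measure < ∞
      rw [G.lintegral_absCollisionIntegral_sq_congr hB]
      simp only [absCollisionIntegral, hbal, enorm_mul]
      simp only [lintegral_const_mul' _ _ (enorm_ne_top (x := c)), mul_pow]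
      rw [lintegral_const_mul' _ _ (ENNReal.pow_ne_top enorm_ne_top)]
      refine ENNReal.mul_lt_top (ENNReal.pow_lt_top enorm_lt_top) ?_
      have : ∫⁻ p, G.absCollisionIntegral x.1 p ^ 2 ∂G.measure < ∞ := hx.1
      simpa only [absCollisionIntegral, enorm_mul] using this
    · refine (Lp.coeFn_smul c x.2).trans ?_
      filter_upwards [hx.2, G.collisionIntegral_congr_ae hB] with p h1 h2
      rw [Prod.smul_fst, h2, Pi.smul_apply, h1]
      simp only [collisionIntegral, hbal]
      rw [integral_const_mul, smul_eq_mul]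

theorem exists_collisionOperator_resolvent : ∃ R : G.State →L[ℂ] G.State, IsSelfAdjoint R ∧
    ∀ x : G.State × G.State, x ∈ G.collisionOperator ↔ x.1 = R (x.1 + x.2) :=
  exists_friedrichs_resolvent G.collisionSubmodule G.collisionGraph_symmetric
    G.collisionGraph_nonneg

theorem mem_collisionOperator_of_balanceOf_eq_zero {e : G.State}
    (h : balanceOf e =ᵐ[G.collisionMeasure] 0) : (e, 0) ∈ G.collisionOperator :=
  subset_friedrichsGraph G.collisionGraph_symmetric (G.mem_collisionGraph_of_balanceOf_eq_zero h)

end Gas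

/-! ### The collision invariants and multiplication operators on the Hilbert space -/

theorem energy_le (m : ℝ) (hm : 0 ≤ m) (p : Momentum) : energy m p ≤ m + ‖p‖ :=
  Real.sqrt_le_iff.2 ⟨by positivity, by nlinarith [norm_nonneg p]⟩

theorem abs_fourMomentum_le (m : ℝ) (p : Momentum) (μ : Fin 4) :
    |fourMomentum m p μ| ≤ energy m p := by
  refine Fin.cases ?_ (fun j => ?_) μ
  · simp [fourMomentum, abs_of_nonneg (energy_nonneg m p)]
  · simp only [fourMomentum, Fin.cons_succ]
    exact (PiLp.norm_apply_le p j).trans (norm_le_energy m p)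

theorem measurable_fourMomentum_apply (m : ℝ) (μ : Fin 4) :
    Measurable fun p => fourMomentum m p μ :=
  (measurable_pi_apply μ).comp (measurable_fourMomentum m)

/-- `(1 + r)⁶ ≤ D exp (c r)`, with an explicit `D`. -/
theorem one_add_pow_six_le {c : ℝ} (hc : 0 < c) {r : ℝ} (hr : 0 ≤ r) :
    (1 + r) ^ 6 ≤ 720 * Real.exp c / c ^ 6 * Real.exp (c * r) := by
  have h := Real.pow_div_factorial_le_exp (c * (1 + r)) (by positivity) 6
  have h6 : ((Nat.factorial 6 : ℕ) : ℝ) = 720 := by norm_num [Nat.factorial]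
  rw [h6, div_le_iff₀ (by norm_num), mul_pow, mul_add, mul_one, Real.exp_add] at h
  rw [div_mul_eq_mul_div, le_div_iff₀ (by positivity)]
  linarith

namespace Gas

variable (G : Gas)

/-- Exponential decay in every direction, from $p^0\ge\|p\|$ and $\beta^\mu$ timelike. -/
theorem feq_le (p : Momentum) :
    G.feq p ≤ Real.exp G.α * Real.exp (-((G.β₀ - ‖G.β‖) * ‖p‖)) := by
  rw [feq, ← Real.exp_add, Real.exp_le_exp]
  have h1 : minkowski (Fin.cons G.β₀ fun j => G.β j) (fourMomentum G.mass p) =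
      -(G.β₀ * energy G.mass p) + inner ℝ G.β p := by
    simp [minkowski, fourMomentum, PiLp.inner_apply, mul_comm]
  have h2 := real_inner_le_norm G.β p
  have h3 : 0 < G.β₀ := (norm_nonneg _).trans_lt G.β_timelike
  have h4 := mul_le_mul_of_nonneg_left (norm_le_energy G.mass p) h3.le
  rw [h1]
  nlinarith

theorem integrable_one_add_energy_sq :
    Integrable (fun p => (1 + energy G.mass p) ^ 2) G.measure := by
  have hE := measurable_energy G.mass
  rw [measure_eq, integrable_withDensity_iff_integrable_smul' G.measurable_density
    (Eventually.of_forall fun _ => ENNReal.ofReal_lt_top)]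
  set c := G.β₀ - ‖G.β‖ with hcdef
  have hc : 0 < c := sub_pos.2 G.β_timelike
  have hm := G.mass_nonneg
  -- Of the six powers of $1+\|p\|$ absorbed by the exponential, two bound $(1+p^0)^2$ and four
  -- leave the decay $(1+\|p\|)^{-4}$, integrable in dimension three.
  set D : ℝ := Real.exp G.α / (2 * Real.pi) ^ 3 * (1 + G.mass) ^ 2 *
    (720 * Real.exp c / c ^ 6) with hD
  have hint : Integrable (fun p : Momentum => D * (1 + ‖p‖) ^ (-4 : ℝ)) :=
    (integrable_one_add_norm (by simp; norm_num)).const_mul D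
  refine hint.mono' ?_ (Eventually.of_forall fun p => ?_)
  · have := G.measurable_density
    exact Measurable.aestronglyMeasurable (by fun_prop)
  have hr := norm_nonneg p
  have h1 := one_add_pow_six_le hc hr
  have h2 := G.feq_le p
  have h3 : 1 + energy G.mass p ≤ (1 + G.mass) * (1 + ‖p‖) := by
    nlinarith [energy_le G.mass hm p, mul_nonneg hm hr]
  have h5 := energy_nonneg G.mass p
  have h6 := (G.feq_pos p).le
  rw [density, ENNReal.toReal_ofReal (by positivity), smul_eq_mul,
    Real.norm_of_nonneg (by positivity), Real.rpow_neg (by positivity),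
    show (4 : ℝ) = ((4 : ℕ) : ℝ) by norm_num, Real.rpow_natCast, ← div_eq_mul_inv,
    le_div_iff₀ (by positivity)]
  have hexp : Real.exp (-(c * ‖p‖)) * Real.exp (c * ‖p‖) = 1 := by
    rw [← Real.exp_add, neg_add_cancel, Real.exp_zero]
  calc G.feq p / (2 * Real.pi) ^ 3 * (1 + energy G.mass p) ^ 2 * (1 + ‖p‖) ^ 4
      ≤ Real.exp G.α * Real.exp (-(c * ‖p‖)) / (2 * Real.pi) ^ 3 *
        ((1 + G.mass) * (1 + ‖p‖)) ^ 2 * (1 + ‖p‖) ^ 4 := by gcongr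
    _ = Real.exp G.α / (2 * Real.pi) ^ 3 * (1 + G.mass) ^ 2 * Real.exp (-(c * ‖p‖)) *
        (1 + ‖p‖) ^ 6 := by ring
    _ ≤ Real.exp G.α / (2 * Real.pi) ^ 3 * (1 + G.mass) ^ 2 * Real.exp (-(c * ‖p‖)) *
        (720 * Real.exp c / c ^ 6 * Real.exp (c * ‖p‖)) := by gcongr
    _ = D * (Real.exp (-(c * ‖p‖)) * Real.exp (c * ‖p‖)) := by rw [hD]; ring
    _ = D := by rw [hexp, mul_one]

theorem memLp_of_abs_le_one_add_energy {h : Momentum → ℝ} (hm : Measurable h)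
    (hle : ∀ p, |h p| ≤ 1 + energy G.mass p) : MemLp (fun p => (h p : ℂ)) 2 G.measure := by
  have h1 : MemLp (fun p => 1 + energy G.mass p) 2 G.measure :=
    (memLp_two_iff_integrable_sq
      ((measurable_energy G.mass).const_add 1).aestronglyMeasurable).2
      G.integrable_one_add_energy_sq
  refine h1.mono (Complex.measurable_ofReal.comp hm).aestronglyMeasurable
    (Eventually.of_forall fun p => ?_)
  rw [Complex.norm_real, Real.norm_eq_abs]
  exact (hle p).trans (le_abs_self _)

theorem integrable_mul_state {h : Momentum → ℝ} (hm : Measurable h)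
    (hle : ∀ p, |h p| ≤ 1 + energy G.mass p) (ψ : G.State) :
    Integrable (fun p => (h p : ℂ) * ψ p) G.measure :=
  (G.memLp_of_abs_le_one_add_energy hm hle).integrable_mul (Lp.memLp ψ)

/-- The collision invariants `1` and `p^ν`. -/
noncomputable def invariant (i : Option (Fin 4)) (p : Momentum) : ℝ :=
  i.elim 1 fun ν => fourMomentum G.mass p ν

theorem measurable_invariant (i : Option (Fin 4)) : Measurable (G.invariant i) := by
  cases i with
  | none => exact measurable_const
  | some ν => exact measurable_fourMomentum_apply G.mass ν

theorem abs_invariant_le (i : Option (Fin 4)) (p : Momentum) :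
    |G.invariant i p| ≤ 1 + energy G.mass p := by
  have h0 := energy_nonneg G.mass p
  cases i with
  | none => simpa [invariant] using h0
  | some ν =>
    have := abs_fourMomentum_le G.mass p ν
    simp only [invariant, Option.elim]
    linarith

/-- The collision invariants, as states. -/
noncomputable def invariantState (i : Option (Fin 4)) : G.State :=
  (G.memLp_of_abs_le_one_add_energy (G.measurable_invariant i) (G.abs_invariant_le i)).toLp

theorem coeFn_invariantState (i : Option (Fin 4)) :
    G.invariantState i =ᵐ[G.measure] fun p => (G.invariant i p : ℂ) := MemLp.coeFn_toLp _

theorem inner_invariantState (i : Option (Fin 4)) (ψ : G.State) :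
    inner ℂ (G.invariantState i) ψ = ∫ p, (G.invariant i p : ℂ) * ψ p ∂G.measure := by
  rw [L2.inner_def]
  refine integral_congr_ae ?_
  filter_upwards [G.coeFn_invariantState i] with p hp
  rw [hp, RCLike.inner_apply, mul_comm]
  simp

theorem invariantState_mem_collisionOperator (i : Option (Fin 4)) :
    (G.invariantState i, 0) ∈ G.collisionOperator := by
  refine G.mem_collisionOperator_of_balanceOf_eq_zero ?_
  filter_upwards [G.balanceOf_congr_ae (G.coeFn_invariantState i), G.ae_conserved] with y h1 h2
  rw [h1, Pi.zero_apply]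
  simp only [balanceOf, ← Complex.ofReal_add, ← Complex.ofReal_sub]
  rw [Complex.ofReal_eq_zero]
  cases i with
  | none => simp [invariant]
  | some ν =>
    have := congrFun h2 ν
    simp only [Pi.add_apply] at this
    simp only [invariant, Option.elim]
    linarith

/-- The hydrodynamic subspace spanned by the collision invariants. -/
noncomputable def invariants : Submodule ℂ G.State :=
  Submodule.span ℂ (Set.range G.invariantState)

instance : FiniteDimensional ℂ G.invariants :=
  FiniteDimensional.span_of_finite ℂ (Set.finite_range _)

theorem mem_invariants_orthogonal_iff (ψ : G.State) :
    ψ ∈ G.invariantsᗮ ↔ ∀ i, ∫ p, (G.invariant i p : ℂ) * ψ p ∂G.measure = 0 := by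
  simp only [← inner_invariantState]
  constructor
  · intro h i
    exact (Submodule.mem_orthogonal _ _).1 h _ (Submodule.subset_span ⟨i, rfl⟩)
  · intro h
    rw [Submodule.mem_orthogonal]
    intro u hu
    induction hu using Submodule.span_induction with
    | mem u hu => obtain ⟨i, rfl⟩ := hu; exact h i
    | zero => exact inner_zero_left _
    | add u v _ _ hu hv => rw [inner_add_left, hu, hv, add_zero]
    | smul c u _ hu => rw [inner_smul_left, hu, mul_zero]

section Multiplier

variable {G}

theorem memLp_mul_state {g : Momentum → ℝ} (hg : Measurable g) {C : ℝ} (hC : ∀ p, |g p| ≤ C)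
    (ψ : G.State) : MemLp (fun p => (g p : ℂ) * ψ p) 2 G.measure :=
  (Lp.memLp ψ).of_le_mul (c := C)
    ((Complex.measurable_ofReal.comp hg).aestronglyMeasurable.mul (Lp.aestronglyMeasurable ψ))
    (Eventually.of_forall fun p => by
      rw [norm_mul, Complex.norm_real]
      exact mul_le_mul_of_nonneg_right (hC p) (norm_nonneg _))

/-- Multiplication by a bounded real function. -/
noncomputable def multiplier {g : Momentum → ℝ} (hg : Measurable g) {C : ℝ}
    (hC : ∀ p, |g p| ≤ C) : G.State →L[ℂ] G.State :=
  LinearMap.mkContinuous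
    { toFun := fun ψ => (memLp_mul_state hg hC ψ).toLp
      map_add' := fun ψ φ => by
        rw [← MemLp.toLp_add]
        refine MemLp.toLp_congr _ _ ?_
        filter_upwards [Lp.coeFn_add ψ φ] with p hp
        rw [hp, Pi.add_apply, Pi.add_apply, mul_add]
      map_smul' := fun c ψ => by
        rw [RingHom.id_apply, ← MemLp.toLp_const_smul]
        refine MemLp.toLp_congr _ _ ?_
        filter_upwards [Lp.coeFn_smul c ψ] with p hp
        rw [hp, Pi.smul_apply, Pi.smul_apply, smul_eq_mul, smul_eq_mul, mul_left_comm] }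
    C fun ψ => by
      refine Lp.norm_le_mul_norm_of_ae_le_mul ?_
      filter_upwards [(memLp_mul_state hg hC ψ).coeFn_toLp] with p hp
      simp only [LinearMap.coe_mk, AddHom.coe_mk]
      rw [hp, norm_mul, Complex.norm_real]
      exact mul_le_mul_of_nonneg_right (hC p) (norm_nonneg _)

variable {g : Momentum → ℝ} (hg : Measurable g) {C : ℝ} (hC : ∀ p, |g p| ≤ C)

theorem coeFn_multiplier (ψ : G.State) :
    multiplier hg hC ψ =ᵐ[G.measure] fun p => (g p : ℂ) * ψ p :=
  (memLp_mul_state hg hC ψ).coeFn_toLp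

theorem isSelfAdjoint_multiplier : IsSelfAdjoint (multiplier (G := G) hg hC) := by
  rw [ContinuousLinearMap.isSelfAdjoint_iff_isSymmetric]
  intro ψ φ
  rw [ContinuousLinearMap.coe_coe, L2.inner_def, L2.inner_def]
  refine integral_congr_ae ?_
  filter_upwards [coeFn_multiplier hg hC ψ, coeFn_multiplier hg hC φ] with p h1 h2
  rw [h1, h2, RCLike.inner_apply, RCLike.inner_apply, map_mul, Complex.conj_ofReal]
  ring

theorem re_inner_multiplier (ψ : G.State) :
    (inner ℂ ψ (multiplier hg hC ψ)).re = ∫ p, g p * ‖ψ p‖ ^ 2 ∂G.measure := by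
  have h : inner ℂ ψ (multiplier hg hC ψ) =
      ((∫ p, g p * ‖ψ p‖ ^ 2 ∂G.measure : ℝ) : ℂ) := by
    rw [L2.inner_def, ← integral_complex_ofReal]
    refine integral_congr_ae ?_
    filter_upwards [coeFn_multiplier hg hC ψ] with p h1
    rw [h1, RCLike.inner_apply, mul_assoc, Complex.mul_conj']
    push_cast
    rfl
  rw [h, Complex.ofReal_re]

theorem integrable_norm_sq_state (ψ : G.State) : Integrable (fun p => ‖ψ p‖ ^ 2) G.measure :=
  (memLp_two_iff_integrable_sq_norm (Lp.aestronglyMeasurable ψ)).1 (Lp.memLp ψ)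

theorem integrable_mul_norm_sq_state {g : Momentum → ℝ} (hg : Measurable g) {C : ℝ}
    (hC : ∀ p, |g p| ≤ C) (ψ : G.State) :
    Integrable (fun p => g p * ‖ψ p‖ ^ 2) G.measure :=
  (integrable_norm_sq_state ψ).bdd_mul hg.aestronglyMeasurable (Eventually.of_forall hC)

theorem norm_sq_state (ψ : G.State) : ‖ψ‖ ^ 2 = ∫ p, ‖ψ p‖ ^ 2 ∂G.measure := by
  have h : (‖ψ‖ ^ 2 : ℂ) = ((∫ p, ‖ψ p‖ ^ 2 ∂G.measure : ℝ) : ℂ) := by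
    have h1 := inner_self_eq_norm_sq_to_K (𝕜 := ℂ) ψ
    refine h1.symm.trans ?_
    rw [L2.inner_def, ← integral_complex_ofReal]
    refine integral_congr_ae (Eventually.of_forall fun p => ?_)
    simp only
    rw [RCLike.inner_apply, Complex.mul_conj']
    push_cast
    rfl
  exact_mod_cast h

theorem le_re_inner_multiplier {c : ℝ} (hc : ∀ p, c ≤ g p) (ψ : G.State) :
    c * ‖ψ‖ ^ 2 ≤ (inner ℂ ψ (multiplier hg hC ψ)).re := by
  rw [re_inner_multiplier, norm_sq_state, ← integral_const_mul]
  exact integral_mono ((integrable_norm_sq_state ψ).const_mul c)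
    (integrable_mul_norm_sq_state hg hC ψ)
    fun p => mul_le_mul_of_nonneg_right (hc p) (by positivity)

theorem re_inner_multiplier_le (ψ : G.State) :
    (inner ℂ ψ (multiplier hg hC ψ)).re ≤ C * ‖ψ‖ ^ 2 := by
  rw [re_inner_multiplier, norm_sq_state, ← integral_const_mul]
  exact integral_mono (integrable_mul_norm_sq_state hg hC ψ)
    ((integrable_norm_sq_state ψ).const_mul C)
    fun p => mul_le_mul_of_nonneg_right ((le_abs_self _).trans (hC p)) (by positivity)

end Multiplier

end Gas

/-! ### The change of observer as a bounded multiplier -/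

theorem lorentzFactor_pos {v : ℝ} (h0 : 0 ≤ v) (h1 : v < 1) : 0 < lorentzFactor v :=
  one_div_pos.2 (Real.sqrt_pos.2 (by nlinarith))

theorem lorentzFactor_sq_mul {v : ℝ} (h0 : 0 ≤ v) (h1 : v < 1) :
    lorentzFactor v ^ 2 * (1 - v ^ 2) = 1 := by
  have h : 0 < 1 - v ^ 2 := by nlinarith
  rw [lorentzFactor, div_pow, Real.sq_sqrt h.le, one_pow, one_div, inv_mul_cancel₀ h.ne']

namespace Gas

variable (G : Gas)

/-- The rate `-u_μ p^μ / p⁰ = γ (1 - V · w)` at which the proper time of the observer of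
velocity `V` runs along the trajectory of a particle. -/
noncomputable def observerRate (V p : Momentum) : ℝ :=
  lorentzFactor ‖V‖ * (1 - ∑ j : Fin 3, G.velocity j p * V j)

theorem measurable_observerRate (V : Momentum) : Measurable (G.observerRate V) := by
  have := measurable_energy G.mass
  unfold observerRate velocity
  fun_prop

theorem abs_sum_velocity_mul_le (V p : Momentum) :
    |∑ j : Fin 3, G.velocity j p * V j| ≤ ‖V‖ := by
  have h1 : ∑ j : Fin 3, G.velocity j p * V j = inner ℝ V p / energy G.mass p := by
    rw [PiLp.inner_apply, Finset.sum_div]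
    refine Finset.sum_congr rfl fun j _ => ?_
    simp [velocity]
    ring
  have h2 := abs_real_inner_le_norm V p
  have h3 := norm_le_energy G.mass p
  have h4 := energy_nonneg G.mass p
  rw [h1, abs_div, abs_of_nonneg h4]
  refine div_le_of_le_mul₀ h4 (norm_nonneg V) (h2.trans ?_)
  gcongr

theorem le_observerRate {V : Momentum} (hV : ‖V‖ < 1) (p : Momentum) :
    lorentzFactor ‖V‖ * (1 - ‖V‖) ≤ G.observerRate V p := by
  have h := (abs_le.1 (G.abs_sum_velocity_mul_le V p)).2
  exact mul_le_mul_of_nonneg_left (by linarith) (lorentzFactor_pos (norm_nonneg V) hV).le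

theorem abs_observerRate_le {V : Momentum} (hV : ‖V‖ < 1) (p : Momentum) :
    |G.observerRate V p| ≤ lorentzFactor ‖V‖ * (1 + ‖V‖) := by
  have h := abs_le.1 (G.abs_sum_velocity_mul_le V p)
  rw [observerRate, abs_mul, abs_of_pos (lorentzFactor_pos (norm_nonneg V) hV)]
  exact mul_le_mul_of_nonneg_left (abs_le.2 ⟨by linarith, by linarith⟩)
    (lorentzFactor_pos (norm_nonneg V) hV).le

/-- Multiplication by the rate of the proper time of an observer. -/
noncomputable def observerMultiplier {V : Momentum} (hV : ‖V‖ < 1) : G.State →L[ℂ] G.State :=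
  multiplier (G.measurable_observerRate V) (G.abs_observerRate_le hV)

theorem coeFn_observerMultiplier {V : Momentum} (hV : ‖V‖ < 1) (ψ : G.State) :
    G.observerMultiplier hV ψ =ᵐ[G.measure] fun p => (G.observerRate V p : ℂ) * ψ p :=
  coeFn_multiplier _ _ ψ

theorem ae_ne_zero : ∀ᵐ p ∂G.measure, p ≠ 0 := by
  have h : G.measure ≪ volume := withDensity_absolutelyContinuous _ _
  have h0 : ∀ᵐ p ∂(volume : Measure Momentum), p ≠ 0 := by simp [ae_iff]
  exact h.ae_le h0

/-- At $p=0$ with $m=0$ the left side is $0$ by the convention for division by zero while the rate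
is $\gamma$, hence the exclusion of that null set. -/
theorem minkowski_fourVelocity_div (V : Momentum) {p : Momentum} (hp : p ≠ 0) :
    minkowski (fourVelocity V) (fourMomentum G.mass p) / energy G.mass p =
      -G.observerRate V p := by
  have h := (energy_pos G.mass hp).ne'
  simp only [minkowski, fourVelocity, fourMomentum, observerRate, velocity, Fin.cons_zero,
    Fin.cons_succ, Fin.sum_univ_three]
  field_simp
  ring

theorem contract_integral (u : Fin 4 → ℝ) {h : Momentum → ℝ} (hm : Measurable h)
    (hle : ∀ p, |h p| ≤ 1 + energy G.mass p) (ψ : G.State) :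
    contract u (fun μ => ∫ p, ((fourMomentum G.mass p μ / energy G.mass p * h p : ℝ) : ℂ) * ψ p
        ∂G.measure) =
      ∫ p, ((minkowski u (fourMomentum G.mass p) / energy G.mass p * h p : ℝ) : ℂ) * ψ p
        ∂G.measure := by
  have hE := measurable_energy G.mass
  have hint : ∀ μ, Integrable
      (fun p => ((fourMomentum G.mass p μ / energy G.mass p * h p : ℝ) : ℂ) * ψ p) G.measure := by
    intro μ
    have hμ := measurable_fourMomentum_apply G.mass μ
    refine G.integrable_mul_state (h := fun p => fourMomentum G.mass p μ / energy G.mass p * h p)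
      (by fun_prop) (fun p => ?_) ψ
    rw [abs_mul, abs_div, abs_of_nonneg (energy_nonneg G.mass p)]
    have h1 : |fourMomentum G.mass p μ| / energy G.mass p ≤ 1 :=
      div_le_one_of_le₀ (abs_fourMomentum_le G.mass p μ) (energy_nonneg G.mass p)
    calc _ ≤ 1 * |h p| := by gcongr
      _ ≤ _ := by rw [one_mul]; exact hle p
  have hint' : ∀ μ, Integrable (fun p => (u μ : ℂ) *
      (((fourMomentum G.mass p μ / energy G.mass p * h p : ℝ) : ℂ) * ψ p)) G.measure :=
    fun μ => (hint μ).const_mul _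
  have hsum : ∀ p, ((minkowski u (fourMomentum G.mass p) / energy G.mass p * h p : ℝ) : ℂ) * ψ p =
      -((u 0 : ℂ) * (((fourMomentum G.mass p 0 / energy G.mass p * h p : ℝ) : ℂ) * ψ p)) +
      ∑ j : Fin 3, (u j.succ : ℂ) *
        (((fourMomentum G.mass p j.succ / energy G.mass p * h p : ℝ) : ℂ) * ψ p) := by
    intro p
    simp only [minkowski, Fin.sum_univ_three]
    push_cast
    ring
  have hneg : Integrable (fun p => -((u 0 : ℂ) *
      (((fourMomentum G.mass p 0 / energy G.mass p * h p : ℝ) : ℂ) * ψ p))) G.measure :=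
    (hint' 0).neg
  have hspace : Integrable (fun p => ∑ j : Fin 3, (u j.succ : ℂ) *
      (((fourMomentum G.mass p j.succ / energy G.mass p * h p : ℝ) : ℂ) * ψ p)) G.measure :=
    integrable_finsetSum _ fun j _ => hint' j.succ
  simp only [hsum]
  rw [integral_add hneg hspace, integral_neg, integral_finsetSum _ fun j _ => hint' j.succ]
  simp only [integral_const_mul, contract]

/-- Contracting $p^\mu/p^0$ with $u_\mu$ produces minus the observer's rate, so the conserved
densities are, up to sign, the pairings of $M\psi$ with the invariants $1$ and $p^\nu$. -/
theorem noConservedDensity_iff {V : Momentum} (hV : ‖V‖ < 1) (ψ : G.State) :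
    G.NoConservedDensity (fourVelocity V) ψ ↔ G.observerMultiplier hV ψ ∈ G.invariantsᗮ := by
  have hkey : ∀ i, ∫ p, (G.invariant i p : ℂ) * G.observerMultiplier hV ψ p ∂G.measure =
      -contract (fourVelocity V) (fun μ => ∫ p, ((fourMomentum G.mass p μ / energy G.mass p *
        G.invariant i p : ℝ) : ℂ) * ψ p ∂G.measure) := by
    intro i
    rw [G.contract_integral _ (G.measurable_invariant i) (G.abs_invariant_le i), ← integral_neg]
    refine integral_congr_ae ?_
    filter_upwards [G.coeFn_observerMultiplier hV ψ, G.ae_ne_zero] with p h1 h2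
    rw [h1, G.minkowski_fourVelocity_div V h2]
    push_cast
    ring
  rw [mem_invariants_orthogonal_iff]
  simp only [hkey, neg_eq_zero]
  rw [Option.forall]
  refine and_congr ?_ Iff.rfl
  simp only [invariant, Option.elim, mul_one]
  rfl

/-- For $k^\mu=\omega u^\mu$ the factor $i\omega\gamma-i\omega\gamma V\cdot w$ is $i\omega$ times
the observer's rate. -/
theorem tendsto_eLpNorm_iff {V : Momentum} (hV : ‖V‖ < 1) (ω : ℂ) (x : ℕ → G.State × G.State) :
    Tendsto (fun n => eLpNorm (fun p => (x n).2 p -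
        Complex.I * (ω * (fourVelocity V 0 : ℂ)) * (x n).1 p +
        (∑ j : Fin 3, (G.velocity j p : ℂ) * (Complex.I * (ω * (fourVelocity V j.succ : ℂ)))) *
          (x n).1 p) 2 G.measure) atTop (𝓝 0) ↔
      Tendsto (fun n => ‖(x n).2 - (Complex.I * ω) • G.observerMultiplier hV (x n).1‖)
        atTop (𝓝 0) := by
  have h : ∀ n, eLpNorm (fun p => (x n).2 p -
        Complex.I * (ω * (fourVelocity V 0 : ℂ)) * (x n).1 p +
        (∑ j : Fin 3, (G.velocity j p : ℂ) * (Complex.I * (ω * (fourVelocity V j.succ : ℂ)))) *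
          (x n).1 p) 2 G.measure =
      ENNReal.ofReal ‖(x n).2 - (Complex.I * ω) • G.observerMultiplier hV (x n).1‖ := by
    intro n
    rw [ofReal_norm, Lp.enorm_def]
    refine eLpNorm_congr_ae ?_
    filter_upwards [Lp.coeFn_sub (x n).2 ((Complex.I * ω) • G.observerMultiplier hV (x n).1),
      Lp.coeFn_smul (Complex.I * ω) (G.observerMultiplier hV (x n).1),
      G.coeFn_observerMultiplier hV (x n).1] with p h1 h2 h3
    rw [h1, Pi.sub_apply, h2, Pi.smul_apply, h3, smul_eq_mul]
    simp only [observerRate, fourVelocity, Fin.cons_zero, Fin.cons_succ, Fin.sum_univ_three]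
    push_cast
    ring
  simp only [h]
  constructor
  · intro ht
    have := (ENNReal.tendsto_toReal ENNReal.zero_ne_top).comp ht
    simpa [Function.comp_def] using this
  · intro ht
    simpa using ENNReal.tendsto_ofReal ht

theorem mem_nonhydroSpectrum_iff {R : G.State →L[ℂ] G.State}
    (hR : ∀ x : G.State × G.State, x ∈ G.collisionOperator ↔ x.1 = R (x.1 + x.2))
    {V : Momentum} (hV : ‖V‖ < 1) (ω : ℂ) : ω ∈ G.nonhydroSpectrum V ↔
      ∃ x : ℕ → G.State × G.State, (∀ n, (x n).1 = R ((x n).1 + (x n).2)) ∧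
        (∀ n, ‖(x n).1‖ = 1) ∧ (∀ n, G.observerMultiplier hV (x n).1 ∈ G.invariantsᗮ) ∧
        Tendsto (fun n => ‖(x n).2 - (Complex.I * ω) • G.observerMultiplier hV (x n).1‖)
          atTop (𝓝 0) := by
  refine exists_congr fun x => ?_
  rw [IsEigenSequence, G.tendsto_eLpNorm_iff hV]
  simp only [hR, G.noConservedDensity_iff hV]
  tauto

/-- It identifies the hypothesis at $V=0$ with the ordinary spectral problem on the complement of
the invariants. -/
theorem observerMultiplier_zero (h : ‖(0 : Momentum)‖ < 1) (ψ : G.State) :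
    G.observerMultiplier h ψ = ψ := by
  refine Lp.ext ((G.coeFn_observerMultiplier h ψ).trans (Eventually.of_forall fun p => ?_))
  simp [observerRate, lorentzFactor]

end Gas

end Kinetic

theorem theorem1 (G : Kinetic.Gas) (hdense : Dense G.collisionDomain)
    (V : Kinetic.Momentum) (hV : ‖V‖ < 1) (a : ℝ) (ha : 0 ≤ a) (b : EReal)
    (hspec : Kinetic.Confined (G.nonhydroSpectrum 0) a b) :
    Kinetic.Confined (G.nonhydroSpectrum V)
      (a * (1 - ‖V‖) / Kinetic.lorentzFactor ‖V‖)
      (b / ((Kinetic.lorentzFactor ‖V‖ * (1 - ‖V‖) : ℝ) : EReal)) := by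
  obtain ⟨R, hRsa, hR⟩ := G.exists_collisionOperator_resolvent
  have hN : ∀ ν ∈ G.invariants, R ν = ν := by
    intro ν hν
    induction hν using Submodule.span_induction with
    | mem u hu =>
      obtain ⟨i, rfl⟩ := hu
      have h := (hR _).1 (G.invariantState_mem_collisionOperator i)
      simpa using h.symm
    | zero => exact map_zero R
    | add u v _ _ hu hv => rw [map_add, hu, hv]
    | smul c u _ hu => rw [map_smul, hu]
  have h0 : ‖(0 : Kinetic.Momentum)‖ < 1 := by simp
  have hγ := Kinetic.lorentzFactor_pos (norm_nonneg V) hV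
  have hγ2 := Kinetic.lorentzFactor_sq_mul (norm_nonneg V) hV
  have hc : 0 < Kinetic.lorentzFactor ‖V‖ * (1 - ‖V‖) := mul_pos hγ (sub_pos.2 hV)
  intro ω hω
  obtain ⟨x, hx, hnorm, horth, hlim⟩ := (G.mem_nonhydroSpectrum_iff hR hV ω).1 hω
  obtain ⟨r, hr, hra, hrb⟩ := Kinetic.exists_real_eq_of_isSelfAdjoint_multiplier hRsa G.invariants
    hN ha (b := b)
    (fun ω' h => hspec ω' ((G.mem_nonhydroSpectrum_iff hR h0 ω').2 (by
      simpa only [Kinetic.Gas.observerMultiplier_zero] using h)))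
    (Kinetic.Gas.isSelfAdjoint_multiplier _ _) hc
    (Kinetic.Gas.le_re_inner_multiplier (G.measurable_observerRate V) (G.abs_observerRate_le hV)
      (G.le_observerRate hV))
    (Kinetic.Gas.re_inner_multiplier_le (G.measurable_observerRate V) (G.abs_observerRate_le hV))
    hx hnorm horth hlim
  refine ⟨r, hr, le_trans ?_ hra, hrb⟩
  have hv := norm_nonneg V
  rw [div_le_div_iff₀ hγ (by positivity)]
  have h1 : a * (1 - ‖V‖) * (Kinetic.lorentzFactor ‖V‖ * (1 + ‖V‖)) =
      a * (Kinetic.lorentzFactor ‖V‖ * (1 - ‖V‖ ^ 2)) := by ring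
  rw [h1]
  refine mul_le_mul_of_nonneg_left ?_ ha
  exact mul_le_of_le_one_right hγ.le (by nlinarith)
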